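/- **Theorem (Convergence of R-AbaSVRG).** *Setting.* Let $\mathcal M$ be a smooth finite-dimensional Riemannian manifold with Riemannian distance $d$ and let $R$ be a (smooth) retraction on $\mathcal M$. Let $\mathcal T$ be an isometric vector transport: linear isometries $\mathcal T_\xi:T_x\mathcal M\to T_{R_x(\xi)}\mathcal M$ with $\mathcal T_{0_x}=\mathrm{id}$. Let $f(x)=\mathbb E_i[f_i(x)]$, where either $i$ is uniform on $\{1,\dots,n\}$, $n\ge 1$ (so $f=\frac1n\sum_{i=1}^n f_i$), or $i$ has an arbitrary probability law. In the second case $f_i(x)$ is integrable in $i$, and for $x\in\mathcal X$ (see (1)) $\mathrm{grad} f_i(x)$ is a measurable function of $i$ with $\mathbb E_i\,\mathrm{grad} f_i(x)=\mathrm{grad} f(x)$. *Assumptions.* There are constants $\rho,G,\sigma,L,L_l,\theta,\mu,\nu>0$ such that the following hold. 1. $\mathcal X$ is a totally retractive neighbourhood of a point $x^*$: for each $x\in\mathcal X$, $R_x$ is a diffeomorphism of $\{\xi\in T_x\mathcal M:\|\xi\|<\rho\}$ onto an open set containing $\mathcal X$. Its inverse is written $R_x^{-1}$, and $\mathcal T_x^y:=\mathcal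 T_{R_x^{-1}(y)}$ for $x,y\in\mathcal X$. The point $x^*$ minimizes $f$ over $\mathcal X$. 2. $f$ and all $f_i$ are $C^2$; for all $x\in\mathcal X$, $\|\mathrm{grad} f_i(x)\|\le G$ for every $i$, and $\mathbb E_i\|\mathrm{grad} f_i(x)-\mathrm{grad} f(x)\|^2\le\sigma^2$. 3. For all $x,y\in\mathcal X$, with $\xi=R_x^{-1}(y)$, and with $P_x^y=(P_y^x)^{-1}$ the (Levi-Civita) parallel transport from $x$ to $y$ along the retraction curve $t\mapsto R_x(t\xi)$, $t\in[0,1]$: - $f(y)\le f(x)+\langle\mathrm{grad} f(x),\xi\rangle+\frac L2\|\xi\|^2$; - $\mathbb E_i\|\mathrm{grad} f_i(x)-P_y^x\,\mathrm{grad} f_i(y)\|^2\le L_l^2\|\xi\|^2$; - $\|\mathcal T_x^y v-P_x^y v\|\le\theta\|\xi\|\|v\|$ for all $v\in T_x\mathcal M$; - $\|\xi\|\le\mu\, d(x,y)$ and $d(x,y)\le\nu\|\xi\|$. *Algorithm.* The input is a step size $\eta>0$, integers $S,m,b\ge1$, an accuracy $\epsilon>0$, parameters $\alpha_1,\alpha_2$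 and $\beta_1\ge 0$, and an initial point $\tilde x^0$. For $s=1,\dots,S$, set $x_0^s=\tilde x^{s-1}$ and $$B^s=\min\{\lceil\alpha_1\sigma^2/\beta_s\rceil,\ \mathrm{cap}\}\qquad(B^s=\mathrm{cap}\text{ if }\beta_s=0).$$ Draw a batch $\mathcal B^s$ of size $B^s$ and set $v_0^s=\mathrm{grad} f_{\mathcal B^s}(x_0^s)$. For $t=0,\dots,m-1$, draw a mini-batch $\mathcal I_t^s$ of $b$ independent indices (with replacement) and set $$v_t^s=\mathrm{grad} f_{\mathcal I_t^s}(x_t^s)-\mathcal T_{x_0^s}^{x_t^s}\big(\mathrm{grad} f_{\mathcal I_t^s}(x_0^s)-v_0^s\big),\qquad x_{t+1}^s=R_{x_t^s}(-\eta v_t^s).$$ Finally set $\tilde x^s=x_m^s$ and $\beta_{s+1}=\frac1m\sum_{t=0}^{m-1}\|v_t^s\|^2$. Here $\mathrm{grad} f_{\mathcal I}$ is the average of $\mathrm{grad} f_i$ over $i\in\mathcal I$. The draws of different epochs and iterations are independent. The output $\tilde x$ is uniformly distributed over the iterates $x_t^s$, $1\le s\le S$, $0\le t\le m-1$. The maximal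 batch size and the batches are as follows. - Finite-sum setting: $\mathrm{cap}=n$; batches are drawn uniformly from $\{1,\dots,n\}$ without replacement. - Online setting: either $n$ components with $\mathrm{cap}=\min\{\lceil\alpha_2\sigma^2/\epsilon^2\rceil,n\}$ and batches drawn without replacement, or an arbitrary law of $i$ with $\mathrm{cap}=\lceil\alpha_2\sigma^2/\epsilon^2\rceil$ and i.i.d. batches. In the latter case the $(x_t^s,v_t^s)$ are assumed to be measurable functions of the samples. The iterates stay continuously in $\mathcal X$: almost surely, $R_{x_t^s}(-\tau\eta v_t^s)\in\mathcal X$ for all $s$, $0\le t\le m-1$ and $\tau\in[0,1]$. *Conclusion.* Let $\alpha\ge4$, $\alpha_1,\alpha_2\ge\alpha$, $\beta_1\le\epsilon^2S$, and $$0<\eta\le\frac{2-\frac2\alpha}{L+\sqrt{L^2+4\left(1-\frac1\alpha\right)\frac{(L_l+\theta G)^2\mu^2\nu^2m^2}{b}}}.$$ Then, in both the finite-sum and the online settings, with $T=Sm$ and $\Delta=f(\tilde x^0)-f(x^*)$, $$\mathbb E\|\mathrm{grad} f(\tilde x)\|^2\le\frac{2\Delta}{T\eta}+\frac{\epsilon^2}{2}.$$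 -/

import Mathlib

open MeasureTheory Bundle
open scoped Manifold ContDiff Topology

noncomputable section

namespace RAba

/-! ### Riemannian gradient and Levi-Civita parallel transport

`M` is a smooth manifold without boundary, modelled on a finite-dimensional real vector space `E`;
the Riemannian metric is the inner product carried by the tangent spaces. -/

section Geometry

variable (E : Type*) [NormedAddCommGroup E] [NormedSpace ℝ E]
  {M : Type*} [TopologicalSpace M] [ChartedSpace E M]
  [RiemannianBundle (fun x : M => TangentSpace 𝓘(ℝ, E) x)]

/-- The Riemannian gradient: the Riesz representative of the differential of `f` at `x`. -/
def grad [FiniteDimensional ℝ E] (f : M → ℝ) (x : M) : TangentSpace 𝓘(ℝ, E) x :=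
  haveI : FiniteDimensional ℝ (TangentSpace 𝓘(ℝ, E) x) := ‹FiniteDimensional ℝ E›
  haveI : CompleteSpace (TangentSpace 𝓘(ℝ, E) x) := FiniteDimensional.complete ℝ _
  (InnerProductSpace.toDual ℝ (TangentSpace 𝓘(ℝ, E) x)).symm (mvfderiv 𝓘(ℝ, E) f x)

/-- The coordinates, in the preferred chart at `p`, of a tangent vector `v` at `q`. -/
def coords (p : M) {q : M} (v : TangentSpace 𝓘(ℝ, E) q) : E :=
  mfderiv 𝓘(ℝ, E) 𝓘(ℝ, E) (extChartAt 𝓘(ℝ, E) p) q v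

/-- The Riemannian metric read in the preferred chart at `p`: `g_y(u, w)` for a point `y` of the
chart domain in `E` and coordinate vectors `u`, `w`. -/
def chartMetric (p : M) (y u w : E) : ℝ :=
  inner ℝ (mfderiv 𝓘(ℝ, E) 𝓘(ℝ, E) (extChartAt 𝓘(ℝ, E) p).symm y u)
    (mfderiv 𝓘(ℝ, E) 𝓘(ℝ, E) (extChartAt 𝓘(ℝ, E) p).symm y w)

/-- The Christoffel symbols of the first kind of the Levi-Civita connection in the chart at `p`:
the number `g_y(Γ_y(u, v), w)`, given by the Koszul formula
`2 g(Γ(u, v), w) = ∂_u g(v, w) + ∂_v g(u, w) - ∂_w g(u, v)`. -/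
def christoffel (p : M) (y u v w : E) : ℝ :=
  (fderiv ℝ (fun y' => chartMetric E p y' v w) y u
    + fderiv ℝ (fun y' => chartMetric E p y' u w) y v
    - fderiv ℝ (fun y' => chartMetric E p y' u v) y w) / 2

/-- The vector field `V` along the curve `c`, on the time interval `[0, 1]`, is parallel for the
Levi-Civita connection: in the chart at `c t`, its coordinates satisfy `V' + Γ(c', V) = 0` at time
`t` (tested against every `w` with the nondegenerate form `g`), for each `t ∈ [0, 1]`. -/
def IsParallelAlong (c : ℝ → M) (V : ∀ t, TangentSpace 𝓘(ℝ, E) (c t)) : Prop :=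
  ∀ t ∈ Set.Icc (0 : ℝ) 1, ∃ c' V' : E,
    HasDerivWithinAt (fun s => extChartAt 𝓘(ℝ, E) (c t) (c s)) c' (Set.Icc 0 1) t ∧
    HasDerivWithinAt (fun s => coords E (c t) (V s)) V' (Set.Icc 0 1) t ∧
    ∀ w : E, chartMetric E (c t) (extChartAt 𝓘(ℝ, E) (c t) (c t)) V' w
      + christoffel E (c t) (extChartAt 𝓘(ℝ, E) (c t) (c t)) c' (coords E (c t) (V t)) w = 0

/-- `P` is the parallel transport along the curve `c : [0, 1] → M` from the tangent space at
`x = c a` to the tangent space at `y = c b` (used for `(a, b) = (0, 1)` and, in the reverse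
direction, for `(a, b) = (1, 0)`). -/
def IsParallelTransport (c : ℝ → M) (a b : ℝ) {x y : M}
    (P : TangentSpace 𝓘(ℝ, E) x →ₗ[ℝ] TangentSpace 𝓘(ℝ, E) y) : Prop :=
  ∀ v : TangentSpace 𝓘(ℝ, E) x, ∃ V : ∀ t, TangentSpace 𝓘(ℝ, E) (c t),
    IsParallelAlong E c V ∧
    (⟨c a, V a⟩ : TangentBundle 𝓘(ℝ, E) M) = ⟨x, v⟩ ∧
    (⟨c b, V b⟩ : TangentBundle 𝓘(ℝ, E) M) = ⟨y, P v⟩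

/-! ### Retractions and vector transports -/

variable [IsManifold 𝓘(ℝ, E) ∞ M]

variable (M) in
/-- A retraction: a smooth map `R : TM → M` with `R_x(0) = x` and `D R_x(0) = id`; the last
condition says that the retraction curve `t ↦ R_x(t ξ)` has velocity `ξ` at `t = 0`. -/
structure Retraction where
  toFun : ∀ x : M, TangentSpace 𝓘(ℝ, E) x → M
  contMDiff : ContMDiff 𝓘(ℝ, E).tangent 𝓘(ℝ, E) ∞
    (fun p : TangentBundle 𝓘(ℝ, E) M => toFun p.1 p.2)
  map_zero : ∀ x, toFun x 0 = x
  deriv_zero : ∀ (x : M) (ξ : TangentSpace 𝓘(ℝ, E) x),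
    (⟨toFun x ((0 : ℝ) • ξ), mfderiv 𝓘(ℝ, ℝ) 𝓘(ℝ, E) (fun t : ℝ => toFun x (t • ξ)) 0 1⟩ :
      TangentBundle 𝓘(ℝ, E) M) = ⟨x, ξ⟩

instance : CoeFun (Retraction E M) (fun _ => ∀ x : M, TangentSpace 𝓘(ℝ, E) x → M) :=
  ⟨Retraction.toFun⟩

variable {E}

/-- `X` is a totally retractive neighbourhood of `p` with radius `ρ`: it is a neighbourhood of `p`
and, for each `x ∈ X`, `R_x` is a diffeomorphism of the ball of radius `ρ` in `T_x M` onto an open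
set that contains `X`. -/
def IsTotallyRetractive (R : Retraction E M) (ρ : ℝ) (X : Set M) (p : M) : Prop :=
  X ∈ 𝓝 p ∧ ∀ x ∈ X,
    Set.InjOn (R x) {ξ | ‖ξ‖ < ρ} ∧
    IsLocalDiffeomorphOn 𝓘(ℝ, TangentSpace 𝓘(ℝ, E) x) 𝓘(ℝ, E) ∞ (R x) {ξ | ‖ξ‖ < ρ} ∧
    X ⊆ R x '' {ξ | ‖ξ‖ < ρ}

open Classical in
/-- The inverse retraction `R_x⁻¹(y)`: the `ξ ∈ T_x M` with `‖ξ‖ < ρ` and `R_x(ξ) = y`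
(and `0` if there is none). -/
def Retraction.inv (R : Retraction E M) (ρ : ℝ) (x y : M) : TangentSpace 𝓘(ℝ, E) x :=
  if h : ∃ ξ : TangentSpace 𝓘(ℝ, E) x, ‖ξ‖ < ρ ∧ R x ξ = y then h.choose else 0

/-- An isometric vector transport associated with `R`: linear isometries
`𝒯_ξ : T_x M → T_{R_x(ξ)} M` with `𝒯_{0_x} v = v`. -/
structure VectorTransport (R : Retraction E M) where
  toFun : ∀ (x : M) (ξ : TangentSpace 𝓘(ℝ, E) x),
    TangentSpace 𝓘(ℝ, E) x →ₗᵢ[ℝ] TangentSpace 𝓘(ℝ, E) (R x ξ)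
  map_zero : ∀ (x : M) (v : TangentSpace 𝓘(ℝ, E) x),
    (⟨R x 0, toFun x 0 v⟩ : TangentBundle 𝓘(ℝ, E) M) = ⟨x, v⟩

open Classical in
/-- The vector transport between points, `𝒯_x^y v = 𝒯_ξ v` with `ξ = R_x⁻¹(y)`
(and `0` if `R_x⁻¹(y)` does not exist). -/
def VectorTransport.between {R : Retraction E M} (T : VectorTransport R) (ρ : ℝ) (x y : M)
    (v : TangentSpace 𝓘(ℝ, E) x) : TangentSpace 𝓘(ℝ, E) y :=
  if h : R x (R.inv ρ x y) = y then h ▸ T.toFun x (R.inv ρ x y) v else 0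

end Geometry

/-! ### The problem and its assumptions -/

/-- The objective `f(x) = 𝔼_z f_z(x)`, with `z` of law `D`. For `Z = Fin n` and `D` the uniform
measure this is the finite sum `(1 / n) ∑ i, f_i(x)`. -/
def objective {M Z : Type*} [MeasurableSpace Z] (D : Measure Z) (F : Z → M → ℝ)
    (x : M) : ℝ := ∫ z, F z x ∂D

/-- In the finite-sum case the objective is the average of the components. -/
theorem objective_uniformOn {M : Type*} (n : ℕ) (F : Fin n → M → ℝ) (x : M) :
    objective (ProbabilityTheory.uniformOn (Set.univ : Set (Fin n))) F x
      = (1 / n : ℝ) * ∑ i, F i x := by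
  have h : ∀ i : Fin n, (ProbabilityTheory.uniformOn Set.univ : Measure (Fin n)).real {i}
      = 1 / n := fun i => by
    simp [measureReal_def, ProbabilityTheory.uniformOn_univ]
  rw [objective, integral_fintype Integrable.of_finite, Finset.mul_sum]
  simp only [h, smul_eq_mul]

section Problem

variable {E : Type*} [NormedAddCommGroup E] [NormedSpace ℝ E] [FiniteDimensional ℝ E]
  {M : Type*} [EMetricSpace M] [ChartedSpace E M] [IsManifold 𝓘(ℝ, E) ∞ M]
  [RiemannianBundle (fun x : M => TangentSpace 𝓘(ℝ, E) x)]
  {Z : Type*} [MeasurableSpace Z]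

/-- The standing assumptions on the components `F z`, the objective `f`, the retraction `R`, the
vector transport `T` and the neighbourhood `X` of the optimal point `xstar`; expectations are over
a component `z` of law `D`. -/
structure Assumptions (R : Retraction E M) (T : VectorTransport R) (ρ : ℝ) (X : Set M) (xstar : M)
    (D : Measure Z) (F : Z → M → ℝ) (G σ L Ll θ μ ν : ℝ) : Prop where
  pos : 0 < ρ ∧ 0 < G ∧ 0 < σ ∧ 0 < L ∧ 0 < Ll ∧ 0 < θ ∧ 0 < μ ∧ 0 < ν
  contMDiff_component : ∀ z, ContMDiff 𝓘(ℝ, E) 𝓘(ℝ, ℝ) 2 (F z)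
  contMDiff_objective : ContMDiff 𝓘(ℝ, E) 𝓘(ℝ, ℝ) 2 (objective D F)
  isMinOn : IsMinOn (objective D F) X xstar
  totallyRetractive : IsTotallyRetractive R ρ X xstar
  grad_bound : ∀ z, ∀ x ∈ X, ‖grad E (F z) x‖ ≤ G
  variance_bound : ∀ x ∈ X, ∫ z, ‖grad E (F z) x - grad E (objective D F) x‖ ^ 2 ∂D ≤ σ ^ 2
  smooth : ∀ x ∈ X, ∀ ξ : TangentSpace 𝓘(ℝ, E) x, ‖ξ‖ < ρ → R x ξ ∈ X →
    objective D F (R x ξ) ≤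
      objective D F x + inner ℝ (grad E (objective D F) x) ξ + L / 2 * ‖ξ‖ ^ 2
  /-- average retraction Lipschitzness in mean square, with the parallel transport from
  `R x ξ` back to `x` along the retraction curve `t ↦ R x (t • ξ)` -/
  lipschitz : ∀ x ∈ X, ∀ ξ : TangentSpace 𝓘(ℝ, E) x, ‖ξ‖ < ρ → R x ξ ∈ X →
    ∃ P : TangentSpace 𝓘(ℝ, E) (R x ξ) →ₗ[ℝ] TangentSpace 𝓘(ℝ, E) x,
      IsParallelTransport E (fun t : ℝ => R x (t • ξ)) 1 0 P ∧
      ∫ z, ‖grad E (F z) x - P (grad E (F z) (R x ξ))‖ ^ 2 ∂D ≤ Ll ^ 2 * ‖ξ‖ ^ 2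
  /-- vector transport and parallel transport along the retraction curve are close -/
  transport_close : ∀ x ∈ X, ∀ ξ : TangentSpace 𝓘(ℝ, E) x, ‖ξ‖ < ρ → R x ξ ∈ X →
    ∃ P : TangentSpace 𝓘(ℝ, E) x →ₗ[ℝ] TangentSpace 𝓘(ℝ, E) (R x ξ),
      IsParallelTransport E (fun t : ℝ => R x (t • ξ)) 0 1 P ∧
      ∀ v, ‖T.toFun x ξ v - P v‖ ≤ θ * ‖ξ‖ * ‖v‖
  /-- the retraction and the Riemannian distance are comparable on `X` -/
  distance : ∀ x ∈ X, ∀ ξ : TangentSpace 𝓘(ℝ, E) x, ‖ξ‖ < ρ → R x ξ ∈ X →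
    ENNReal.ofReal ‖ξ‖ ≤ ENNReal.ofReal μ * edist x (R x ξ) ∧
    edist x (R x ξ) ≤ ENNReal.ofReal (ν * ‖ξ‖)

variable (E) in
/-- For an infinite population, the gradient oracle is unbiased: `f_z(x)` is integrable in `z` and
`grad f_z(x)` is measurable in `z` with mean `grad f(x)`. -/
structure UnbiasedOracle (X : Set M) (D : Measure Z) (F : Z → M → ℝ) : Prop where
  integrable : ∀ x, Integrable (fun z => F z x) D
  measurable : ∀ x ∈ X, AEStronglyMeasurable (fun z => grad E (F z) x) D
  unbiased : ∀ x ∈ X, ∫ z, grad E (F z) x ∂D = grad E (objective D F) x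

end Problem

/-! ### The algorithm -/

/-- The input of the algorithm: step size `η`, number of epochs `S`, inner loop size `m`, mini-batch
size `b`, the batch size parameters, the initial `β₁` and the initial point. The batch size rule is
`min {α₁ σ² / β_s, cap}`, where `cap` is the largest batch size. -/
structure Input (M : Type*) where
  η : ℝ
  S : ℕ
  m : ℕ
  b : ℕ
  α₁ : ℝ
  σ : ℝ
  cap : ℕ
  β₁ : ℝ
  start : M

open Classical in
/-- The adaptive batch size `min {α₁ σ² / β, cap}`, the ratio being rounded up to an integer and
read as `+∞` if `β = 0`. -/
def Input.batchSize {M : Type*} (A : Input M) (β : ℝ) : ℕ :=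
  if β = 0 then A.cap else min ⌈A.α₁ * A.σ ^ 2 / β⌉₊ A.cap

/-- The samples drawn during a run: in each epoch a sequence of `N` components, of which the batch
is the initial segment of length `B^s`, and for each inner iteration a mini-batch of `b`
components. -/
abbrev Samples (S m b N : ℕ) (Z : Type*) := Fin S → (Fin N → Z) × (Fin m → Fin b → Z)

/-- The law of the samples: independent over the epochs, the mini-batches being i.i.d. with law `D`
(sampling with replacement) and independent of the sequence that provides the batch, which has
law `Q`. -/
def sampleLaw {Z : Type*} [MeasurableSpace Z] (S m b N : ℕ) (Q : Measure (Fin N → Z))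
    (D : Measure Z) : Measure (Samples S m b N Z) :=
  Measure.pi fun _ => Q.prod (Measure.pi fun _ => Measure.pi fun _ => D)

/-- A uniformly random ordering of `{1, …, n}`: its first `B` entries are a sample of size `B` drawn
uniformly without replacement. -/
def orderingLaw (n : ℕ) : Measure (Fin n → Fin n) :=
  ProbabilityTheory.uniformOn {g | Function.Injective g}

section Algorithm

variable {E : Type*} [NormedAddCommGroup E] [NormedSpace ℝ E] [FiniteDimensional ℝ E]
  {M : Type*} [TopologicalSpace M] [ChartedSpace E M] [IsManifold 𝓘(ℝ, E) ∞ M]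
  [RiemannianBundle (fun x : M => TangentSpace 𝓘(ℝ, E) x)]
  {Z : Type*} {R : Retraction E M} (T : VectorTransport R) (ρ : ℝ) (F : Z → M → ℝ)

/-- The batch gradient at `x` over the first `B` entries of the sequence `ζ`. -/
def batchGrad {N : ℕ} (B : ℕ) (ζ : Fin N → Z) (x : M) : TangentSpace 𝓘(ℝ, E) x :=
  (B : ℝ)⁻¹ • ∑ j : Fin N with j.val < B, grad E (F (ζ j)) x

/-- The modified gradient at `x`, with snapshot `x₀`, batch gradient `v₀` and mini-batch `I`:
`grad f_I(x) - 𝒯_{x₀}^x (grad f_I(x₀) - v₀)`. -/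
def modifiedGrad {b : ℕ} (x₀ : M) (v₀ : TangentSpace 𝓘(ℝ, E) x₀) (I : Fin b → Z) (x : M) :
    TangentSpace 𝓘(ℝ, E) x :=
  batchGrad F b I x - T.between ρ x₀ x (batchGrad F b I x₀ - v₀)

/-- The iterates `x_0, …, x_m` of one epoch. -/
def innerIterate {m b : ℕ} (η : ℝ) (x₀ : M) (v₀ : TangentSpace 𝓘(ℝ, E) x₀)
    (I : Fin m → Fin b → Z) : Fin (m + 1) → M :=
  Fin.induction (motive := fun _ => M) x₀
    fun t x => R x (-(η • modifiedGrad T ρ F x₀ v₀ (I t) x))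

variable (A : Input M) {N : ℕ} (smp : Samples A.S A.m A.b N Z)

/-- The state `(x̃^s, β_{s+1})` after `s` epochs. -/
def epochState : Fin (A.S + 1) → M × ℝ :=
  Fin.induction (motive := fun _ => M × ℝ) (A.start, A.β₁) fun s st =>
    let v₀ : TangentSpace 𝓘(ℝ, E) st.1 := batchGrad F (A.batchSize st.2) (smp s).1 st.1
    let x := innerIterate T ρ F A.η st.1 v₀ (smp s).2
    (x (Fin.last A.m),
      ∑ t : Fin A.m, ‖modifiedGrad T ρ F st.1 v₀ ((smp s).2 t) (x t.castSucc)‖ ^ 2 / A.m)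

/-- The snapshot point of an epoch. -/
def snapshot (s : Fin A.S) : M := (epochState T ρ F A smp s.castSucc).1

/-- The batch gradient at the snapshot point of an epoch. -/
def snapshotGrad (s : Fin A.S) : TangentSpace 𝓘(ℝ, E) (snapshot T ρ F A smp s) :=
  batchGrad F (A.batchSize (epochState T ρ F A smp s.castSucc).2) (smp s).1 (snapshot T ρ F A smp s)

/-- The iterate `x_t^s`, for `t = 0, …, m - 1`. -/
def iterate (s : Fin A.S) (t : Fin A.m) : M :=
  innerIterate T ρ F A.η (snapshot T ρ F A smp s) (snapshotGrad T ρ F A smp s) (smp s).2 t.castSucc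

/-- The modified gradient `v_t^s`, for `t = 0, …, m - 1`. -/
def direction (s : Fin A.S) (t : Fin A.m) : TangentSpace 𝓘(ℝ, E) (iterate T ρ F A smp s t) :=
  modifiedGrad T ρ F (snapshot T ρ F A smp s) (snapshotGrad T ρ F A smp s) ((smp s).2 t)
    (iterate T ρ F A smp s t)

/-- In the run with samples `smp`, the iterates stay continuously in `X`: each step moves inside `X`
along the retraction curve. -/
def StaysIn (X : Set M) : Prop :=
  ∀ s t, ∀ τ ∈ Set.Icc (0 : ℝ) 1,
    R (iterate T ρ F A smp s t) (-((τ * A.η) • direction T ρ F A smp s t)) ∈ X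

variable [MeasurableSpace Z]

/-- The iterates and the modified gradients are random variables: `(x_t^s, v_t^s)` is a Borel
function of the samples with values in the tangent bundle. -/
def IsMeasurableRun (N : ℕ) : Prop :=
  ∀ s t, @Measurable (Samples A.S A.m A.b N Z) (TangentBundle 𝓘(ℝ, E) M) _ (borel _)
    fun smp => ⟨iterate T ρ F A smp s t, direction T ρ F A smp s t⟩

/-- The output `x̃` is an iterate `x_t^s` with `(s, t)` uniform and independent of the samples, and
`𝔼 ‖grad f(x̃)‖²` is finite and at most `bound`. -/
def OutputBound (f : M → ℝ) (P : Measure (Samples A.S A.m A.b N Z))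
    (bound : ℝ) : Prop :=
  Integrable (fun p : Samples A.S A.m A.b N Z × (Fin A.S × Fin A.m) =>
      ‖grad E f (iterate T ρ F A p.1 p.2.1 p.2.2)‖ ^ 2)
    (P.prod (ProbabilityTheory.uniformOn Set.univ)) ∧
  ∫ p : Samples A.S A.m A.b N Z × (Fin A.S × Fin A.m),
      ‖grad E f (iterate T ρ F A p.1 p.2.1 p.2.2)‖ ^ 2
    ∂(P.prod (ProbabilityTheory.uniformOn Set.univ)) ≤ bound

end Algorithm

end RAba

end

/-! Write `g` for the gradient of the objective at an iterate and `v` for the direction used there.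
Smoothness along one step and `2⟪g, v⟫ = ‖g‖² + ‖v‖² - ‖v - g‖²` bound `‖g‖² + (1 - Lη)‖v‖²` by
`2/η` times the decrease of the objective, plus `‖v - g‖²` (`norm_sq_add_le_of_descent`). Over the
whole run the decreases telescope, so it remains to absorb the expected errors `‖v - g‖²` into the
terms `‖v‖²`, up to `ε²/2` per iteration.

The error is mini-batch noise plus the transported snapshot error, and the two are orthogonal in
mean (`lintegral_modifiedGrad_le`). The noise is governed by the distance to the snapshot, hence by
the lengths of the steps of the epoch; Cauchy-Schwarz turns it into a multiple of the sum of `‖v‖²`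
over that epoch (`lintegral_error_le`). The snapshot error is at most `(β + ε²)/α`: an uncapped
batch costs `β/α`, a capped one costs `ε²/α` or is the exact full gradient. Since `β` is the mean of
`‖v‖²` over the previous epoch, this cost returns to the same sum of `‖v‖²` with factor `1/α`. The
step size bound is a root of the quadratic that keeps the remaining coefficient nonnegative
(`step_condition`, `bound_of_sums`).

Two devices support this. Parallel transport preserves the metric, so the Lipschitz estimate can be
read at either end of the retraction curve and compared with the vector transport
(`IsParallelTransport.norm_sub_eq`). Conditioning on the past is replaced by resampling: overwriting
one independent block of samples by a fresh copy preserves the law, while the iterate in question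
does not see that block (`lintegral_le_of_resample`). -/

set_option linter.unusedSectionVars false

noncomputable section

namespace RAba

/-! ### Levi-Civita parallel transport is isometric -/

section Parallel

variable {E : Type*} [NormedAddCommGroup E] [NormedSpace ℝ E] [FiniteDimensional ℝ E]
  {M : Type*} [TopologicalSpace M] [ChartedSpace E M] [IsManifold 𝓘(ℝ, E) ∞ M]
  [RiemannianBundle (fun x : M => TangentSpace 𝓘(ℝ, E) x)]

theorem mfderiv_extChartAt_symm_coords {p q : M} (hq : q ∈ (extChartAt 𝓘(ℝ, E) p).source)
    (v : TangentSpace 𝓘(ℝ, E) q) :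
    (⟨(extChartAt 𝓘(ℝ, E) p).symm (extChartAt 𝓘(ℝ, E) p q),
      mfderiv 𝓘(ℝ, E) 𝓘(ℝ, E) (extChartAt 𝓘(ℝ, E) p).symm (extChartAt 𝓘(ℝ, E) p q)
        (coords E p v)⟩ : TangentBundle 𝓘(ℝ, E) M) = ⟨q, v⟩ := by
  have : IsManifold 𝓘(ℝ, E) 1 M := IsManifold.of_le (n := ∞) (by norm_num)
  have h := mfderivWithin_extChartAt_symm_comp_mfderiv_extChartAt' (I := 𝓘(ℝ, E)) hq
  have h' := DFunLike.congr_fun h v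
  rw [modelWithCornersSelf_coe, Set.range_id, mfderivWithin_univ] at h'
  have h1 : (extChartAt 𝓘(ℝ, E) p).symm (extChartAt 𝓘(ℝ, E) p q) = q :=
    (extChartAt 𝓘(ℝ, E) p).left_inv hq
  refine Bundle.TotalSpace.ext h1 ?_
  exact heq_of_eq h'

/-- Base points here often agree only propositionally; equality in the total space avoids casts
between fibres. -/
theorem inner_congr_totalSpace {p q : M} {a b : TangentSpace 𝓘(ℝ, E) p}
    {a' b' : TangentSpace 𝓘(ℝ, E) q}
    (ha : (⟨p, a⟩ : TangentBundle 𝓘(ℝ, E) M) = ⟨q, a'⟩)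
    (hb : (⟨p, b⟩ : TangentBundle 𝓘(ℝ, E) M) = ⟨q, b'⟩) :
    inner ℝ a b = inner ℝ a' b' := by
  cases ha
  cases hb
  rfl

theorem chartMetric_coords {p q : M} (hq : q ∈ (extChartAt 𝓘(ℝ, E) p).source)
    (v w : TangentSpace 𝓘(ℝ, E) q) :
    chartMetric E p (extChartAt 𝓘(ℝ, E) p q) (coords E p v) (coords E p w) = inner ℝ v w :=
  inner_congr_totalSpace (mfderiv_extChartAt_symm_coords hq v)
    (mfderiv_extChartAt_symm_coords hq w)

theorem chartMetric_comm (p : M) (y u w : E) : chartMetric E p y u w = chartMetric E p y w u :=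
  real_inner_comm _ _

/-- Metric compatibility in coordinates: in the Koszul formula the other two derivatives cancel on
symmetrising. -/
theorem christoffel_add_christoffel_comm (p : M) (y u v w : E) :
    christoffel E p y u v w + christoffel E p y u w v
      = fderiv ℝ (fun y' => chartMetric E p y' v w) y u := by
  have h : (fun y' => chartMetric E p y' w v) = fun y' => chartMetric E p y' v w :=
    funext fun _ => chartMetric_comm ..
  simp only [christoffel, h]
  ring

/-- The differential of the inverse of the preferred chart at `p`. -/
def chartPush (p : M) (y : E) :
    E →L[ℝ] TangentSpace 𝓘(ℝ, E) ((extChartAt 𝓘(ℝ, E) p).symm y) :=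
  mfderiv 𝓘(ℝ, E) 𝓘(ℝ, E) (extChartAt 𝓘(ℝ, E) p).symm y

/-- The metric in a chart as a bilinear map. -/
def chartMetricBilin (p : M) (y : E) : E →ₗ[ℝ] E →ₗ[ℝ] ℝ :=
  LinearMap.mk₂ ℝ (chartMetric E p y)
    (fun u u' w => (congrArg (fun z : TangentSpace 𝓘(ℝ, E) ((extChartAt 𝓘(ℝ, E) p).symm y) =>
      (inner ℝ z (chartPush p y w) : ℝ)) ((chartPush p y).map_add u u')).trans
        (inner_add_left _ _ _))
    (fun c u w => (congrArg (fun z : TangentSpace 𝓘(ℝ, E) ((extChartAt 𝓘(ℝ, E) p).symm y) =>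
      (inner ℝ z (chartPush p y w) : ℝ)) ((chartPush p y).map_smul c u)).trans
        (real_inner_smul_left _ _ _))
    (fun u w w' => (congrArg (fun z : TangentSpace 𝓘(ℝ, E) ((extChartAt 𝓘(ℝ, E) p).symm y) =>
      (inner ℝ (chartPush p y u) z : ℝ)) ((chartPush p y).map_add w w')).trans
        (inner_add_right _ _ _))
    (fun c u w => (congrArg (fun z : TangentSpace 𝓘(ℝ, E) ((extChartAt 𝓘(ℝ, E) p).symm y) =>
      (inner ℝ (chartPush p y u) z : ℝ)) ((chartPush p y).map_smul c w)).trans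
        (real_inner_smul_right _ _ _))

variable [IsContMDiffRiemannianBundle 𝓘(ℝ, E) ∞ E (fun x : M => TangentSpace 𝓘(ℝ, E) x)]

/-- The coordinate fields are the tangent map of the smooth inverse chart applied to constant
sections, hence C¹, and the metric is smooth on C¹ sections. -/
theorem differentiableAt_chartMetric (p : M) {y : E}
    (hy : y ∈ (extChartAt 𝓘(ℝ, E) p).target) (u w : E) :
    DifferentiableAt ℝ (fun y' => chartMetric E p y' u w) y := by
  have ht : IsOpen (extChartAt 𝓘(ℝ, E) p).target := isOpen_extChartAt_target p
  have hs : ContMDiffOn 𝓘(ℝ, E) 𝓘(ℝ, E) ∞ (extChartAt 𝓘(ℝ, E) p).symm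
    (extChartAt 𝓘(ℝ, E) p).target := contMDiffOn_extChartAt_symm p
  have hsec : ∀ u : E, ContMDiffAt 𝓘(ℝ, E) 𝓘(ℝ, E).tangent 1
      (fun y' : E => (⟨(extChartAt 𝓘(ℝ, E) p).symm y',
        mfderiv 𝓘(ℝ, E) 𝓘(ℝ, E) (extChartAt 𝓘(ℝ, E) p).symm y' u⟩ : TangentBundle 𝓘(ℝ, E) M)) y := by
    intro u
    have h1 := hs.contMDiffOn_tangentMapWithin (m := 1) (by norm_num; exact ENat.LEInfty.out) ht.uniqueMDiffOn
    have h2 : ContMDiff 𝓘(ℝ, E) 𝓘(ℝ, E).tangent 1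
        (fun y' : E => (⟨y', u⟩ : TangentBundle 𝓘(ℝ, E) E)) := by
      intro y'
      rw [contMDiffAt_totalSpace]
      refine ⟨contMDiffAt_id, ?_⟩
      simp only [trivializationAt_model_space_apply]
      exact contMDiffAt_const
    have h3 := h1.comp (h2.contMDiffOn (s := (extChartAt 𝓘(ℝ, E) p).target)) (fun y' hy' => hy')
    refine (h3.contMDiffAt (ht.mem_nhds hy)).congr_of_eventuallyEq ?_
    filter_upwards [ht.mem_nhds hy] with y' hy'
    simp only [Function.comp, tangentMapWithin, mfderivWithin_of_isOpen ht hy']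
  have h4 : ContMDiffAt 𝓘(ℝ, E) 𝓘(ℝ, ℝ) 1 (fun y' => chartMetric E p y' u w) y :=
    ContMDiffAt.inner_bundle (F := E) (E := fun x : M => TangentSpace 𝓘(ℝ, E) x)
      (b := (extChartAt 𝓘(ℝ, E) p).symm) (hsec u) (hsec w)
  exact (h4.contDiffAt.differentiableAt (by norm_num))

/-- Product rule for `g_γ(a, b)`. Differentiability in the base point is known for fixed vectors
only, so the form is expanded in a basis. -/
theorem hasDerivWithinAt_chartMetric (p : M) {s : Set ℝ} {t : ℝ} {γ a b : ℝ → E} {γ' a' b' : E}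
    (hγt : γ t ∈ (extChartAt 𝓘(ℝ, E) p).target)
    (hγ : HasDerivWithinAt γ γ' s t) (ha : HasDerivWithinAt a a' s t)
    (hb : HasDerivWithinAt b b' s t) :
    HasDerivWithinAt (fun r => chartMetric E p (γ r) (a r) (b r))
      (fderiv ℝ (fun y => chartMetric E p y (a t) (b t)) (γ t) γ'
        + chartMetric E p (γ t) a' (b t) + chartMetric E p (γ t) (a t) b') s t := by
  let B := Module.finBasis ℝ E
  let g : Fin _ → Fin _ → E → ℝ := fun i j y => chartMetric E p y (B i) (B j)
  have hexp : ∀ y u w, chartMetric E p y u w = ∑ i, ∑ j, B.coord i u * (B.coord j w * g i j y) := by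
    intro y u w
    change chartMetricBilin p y u w = _
    conv_lhs => rw [← B.sum_repr u, ← B.sum_repr w]
    simp only [map_sum, map_smul, LinearMap.sum_apply, LinearMap.smul_apply, smul_eq_mul,
      Finset.mul_sum]
    rw [Finset.sum_comm]
    refine Finset.sum_congr rfl fun i _ => Finset.sum_congr rfl fun j _ => ?_
    rw [show chartMetricBilin p y (B i) (B j) = g i j y from rfl]
    exact mul_left_comm _ _ _
  have hg : ∀ i j, HasFDerivAt (g i j) (fderiv ℝ (g i j) (γ t)) (γ t) := fun i j =>
    (differentiableAt_chartMetric p hγt _ _).hasFDerivAt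
  have hgd : ∀ i j, HasDerivWithinAt (fun r => g i j (γ r)) (fderiv ℝ (g i j) (γ t) γ') s t :=
    fun i j => (hg i j).comp_hasDerivWithinAt t hγ
  have hc : ∀ i {a : ℝ → E} {a' : E}, HasDerivWithinAt a a' s t →
      HasDerivWithinAt (fun r => B.coord i (a r)) (B.coord i a') s t := fun i a a' h =>
    ((B.coord i).toContinuousLinearMap.hasFDerivAt).comp_hasDerivWithinAt t h
  have hf : fderiv ℝ (fun y => chartMetric E p y (a t) (b t)) (γ t) γ'
      = ∑ i, ∑ j, B.coord i (a t) * (B.coord j (b t) * fderiv ℝ (g i j) (γ t) γ') := by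
    have : HasFDerivAt (fun y => chartMetric E p y (a t) (b t))
        (∑ i, ∑ j, B.coord i (a t) • (B.coord j (b t) • fderiv ℝ (g i j) (γ t))) (γ t) := by
      simp only [hexp]
      exact HasFDerivAt.fun_sum fun i _ => HasFDerivAt.fun_sum fun j _ =>
        ((hg i j).const_mul _).const_mul _
    rw [this.fderiv]
    simp
  have hmain : HasDerivWithinAt
      (fun r => ∑ i, ∑ j, B.coord i (a r) * (B.coord j (b r) * g i j (γ r)))
      (∑ i, ∑ j, (B.coord i a' * (B.coord j (b t) * g i j (γ t)) + B.coord i (a t) *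
        (B.coord j b' * g i j (γ t) + B.coord j (b t) * fderiv ℝ (g i j) (γ t) γ'))) s t :=
    HasDerivWithinAt.fun_sum fun i _ => HasDerivWithinAt.fun_sum fun j _ =>
      (hc i ha).mul ((hc j hb).mul (hgd i j))
  rw [hf]
  simp only [hexp]
  convert hmain using 1
  simp only [← Finset.sum_add_distrib]
  refine Finset.sum_congr rfl fun i _ => Finset.sum_congr rfl fun j _ => ?_
  ring

/-- Parallel fields along a continuous curve have constant inner product. -/
theorem IsParallelAlong.inner_eq {c : ℝ → M} (hc : Continuous c)
    {V W : ∀ t, TangentSpace 𝓘(ℝ, E) (c t)} (hV : IsParallelAlong E c V)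
    (hW : IsParallelAlong E c W) :
    ∀ t ∈ Set.Icc (0 : ℝ) 1, (inner ℝ (V t) (W t) : ℝ) = inner ℝ (V 0) (W 0) := by
  have hd : ∀ t ∈ Set.Icc (0 : ℝ) 1,
      HasDerivWithinAt (fun r => (inner ℝ (V r) (W r) : ℝ)) 0 (Set.Icc 0 1) t := by
    intro t ht
    obtain ⟨c', V', hc', hV', hVp⟩ := hV t ht
    obtain ⟨c'', W', hc'', hW', hWp⟩ := hW t ht
    have hu : UniqueDiffWithinAt ℝ (Set.Icc (0 : ℝ) 1) t := uniqueDiffOn_Icc_zero_one t ht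
    -- Each parallel field brings its own velocity of the curve; derivatives within `[0, 1]` are
    -- unique.
    obtain rfl : c' = c'' := by
      have := hc'.derivWithin hu
      rwa [hc''.derivWithin hu, eq_comm] at this
    have hmem : extChartAt 𝓘(ℝ, E) (c t) (c t) ∈ (extChartAt 𝓘(ℝ, E) (c t)).target :=
      mem_extChartAt_target _
    have hder := hasDerivWithinAt_chartMetric (c t) hmem hc' hV' hW'
    have h0 := hVp (coords E (c t) (W t))
    have h1 := hWp (coords E (c t) (V t))
    have h2 := christoffel_add_christoffel_comm (c t) (extChartAt 𝓘(ℝ, E) (c t) (c t)) c'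
      (coords E (c t) (V t)) (coords E (c t) (W t))
    rw [chartMetric_comm] at h1
    -- The derivative of the inner product regroups into the two parallel equations, each of which
    -- is zero.
    rw [← h2, show ∀ x y z w : ℝ, x + y + z + w = (z + x) + (w + y) by intros; ring, h0, h1,
      add_zero] at hder
    have hev : ∀ᶠ r in 𝓝[Set.Icc 0 1] t, c r ∈ (extChartAt 𝓘(ℝ, E) (c t)).source :=
      (hc.continuousAt.eventually_mem (extChartAt_source_mem_nhds _)).filter_mono
        nhdsWithin_le_nhds
    refine hder.congr_of_eventuallyEq ?_ ?_
    · filter_upwards [hev] with r hr using (chartMetric_coords hr _ _).symm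
    · exact (chartMetric_coords (mem_extChartAt_source _) _ _).symm
  exact constant_of_derivWithin_zero (fun t ht => (hd t ht).differentiableWithinAt)
    fun t ht => (hd t (Set.Ico_subset_Icc_self ht)).derivWithin
      (uniqueDiffOn_Icc_zero_one t (Set.Ico_subset_Icc_self ht))

/-- Parallel transports along a curve in the two directions are mutually inverse isometries. -/
theorem IsParallelTransport.norm_sub_eq {c : ℝ → M} (hc : Continuous c) {x y : M}
    {P : TangentSpace 𝓘(ℝ, E) x →ₗ[ℝ] TangentSpace 𝓘(ℝ, E) y}
    {P' : TangentSpace 𝓘(ℝ, E) y →ₗ[ℝ] TangentSpace 𝓘(ℝ, E) x}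
    (hP : IsParallelTransport E c 0 1 P) (hP' : IsParallelTransport E c 1 0 P')
    (v : TangentSpace 𝓘(ℝ, E) x) (w : TangentSpace 𝓘(ℝ, E) y) :
    ‖P v - w‖ = ‖v - P' w‖ := by
  obtain ⟨V, hV, hV0, hV1⟩ := hP v
  obtain ⟨W, hW, hW1, hW0⟩ := hP' w
  have h1 : (1 : ℝ) ∈ Set.Icc (0 : ℝ) 1 := by simp
  -- `e1` and `e3` say that `P` and `P'` preserve norms, `e2` that they are adjoint; expanding both
  -- squares then suffices.
  have e1 := hV.inner_eq hc hV 1 h1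
  have e2 := hV.inner_eq hc hW 1 h1
  have e3 := hW.inner_eq hc hW 1 h1
  rw [inner_congr_totalSpace hV1 hV1, inner_congr_totalSpace hV0 hV0] at e1
  rw [inner_congr_totalSpace hV1 hW1, inner_congr_totalSpace hV0 hW0] at e2
  rw [inner_congr_totalSpace hW1 hW1, inner_congr_totalSpace hW0 hW0] at e3
  rw [← sq_eq_sq₀ (norm_nonneg _) (norm_nonneg _), @norm_sub_sq_real, @norm_sub_sq_real,
    ← real_inner_self_eq_norm_sq, ← real_inner_self_eq_norm_sq, ← real_inner_self_eq_norm_sq,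
    ← real_inner_self_eq_norm_sq, e1, e2, e3]

end Parallel

/-! ### Totally retractive neighbourhoods -/

section Retractive

variable {E : Type*} [NormedAddCommGroup E] [NormedSpace ℝ E]
  {M : Type*} [TopologicalSpace M] [ChartedSpace E M]
  [RiemannianBundle (fun x : M => TangentSpace 𝓘(ℝ, E) x)] [IsManifold 𝓘(ℝ, E) ∞ M]

theorem Retraction.continuous_smul (R : Retraction E M) (x : M) (ξ : TangentSpace 𝓘(ℝ, E) x) :
    Continuous fun t : ℝ => R x (t • ξ) := by
  have h1 : Continuous fun t : ℝ => (⟨x, t • ξ⟩ : TangentBundle 𝓘(ℝ, E) M) :=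
    (FiberBundle.continuous_totalSpaceMk E (TangentSpace 𝓘(ℝ, E)) x).comp
      (continuous_id.smul continuous_const)
  exact R.contMDiff.continuous.comp h1

/-- Needed because the assumptions speak only of vectors shorter than `ρ`. If `‖w‖ ≥ ρ`, the curve
at the time when `τw` reaches length `ρ` is also `R x ξ` with `‖ξ‖ < ρ`. Just before that time the
local diffeomorphism at `ξ` and injectivity on the ball force `τw` to be near `ξ`, so its length
cannot tend to `ρ`. -/
theorem IsTotallyRetractive.norm_lt {R : Retraction E M} {ρ : ℝ} (hρ : 0 < ρ) {X : Set M} {p x : M}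
    (h : IsTotallyRetractive R ρ X p) (hx : x ∈ X) {w : TangentSpace 𝓘(ℝ, E) x}
    (hw : ∀ τ ∈ Set.Icc (0 : ℝ) 1, R x (τ • w) ∈ X) : ‖w‖ < ρ := by
  by_contra! hle
  obtain ⟨hinj, hloc, hsub⟩ := h.2 x hx
  have hw0 : 0 < ‖w‖ := hρ.trans_le hle
  set τ₀ := ρ / ‖w‖ with hτ₀
  have hτpos : 0 < τ₀ := div_pos hρ hw0
  have hτle : τ₀ ≤ 1 := (div_le_one hw0).2 hle
  have hτw : τ₀ * ‖w‖ = ρ := div_mul_cancel₀ _ hw0.ne'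
  obtain ⟨ξ, hξ, hξeq⟩ := hsub (hw τ₀ ⟨hτpos.le, hτle⟩)
  have hξ' : ‖ξ‖ < ρ := hξ
  -- A midpoint, so that the limit argument ends in `ρ ≤ r < ρ`.
  set r := (‖ξ‖ + ρ) / 2 with hr
  have hU : {ζ : TangentSpace 𝓘(ℝ, E) x | ‖ζ‖ < r} ∈ 𝓝 ξ :=
    (isOpen_lt continuous_norm continuous_const).mem_nhds
      (show ‖ξ‖ < r by rw [hr]; linarith)
  have himg : R x '' {ζ : TangentSpace 𝓘(ℝ, E) x | ‖ζ‖ < r} ∈ 𝓝 (R x (τ₀ • w)) := by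
    rw [← hξeq, ← hloc.isLocalHomeomorphOn.map_nhds_eq hξ]
    exact Filter.image_mem_map hU
  have hev := (R.continuous_smul x w).continuousAt.eventually_mem (x := τ₀) himg
  have hev' : ∀ᶠ τ in 𝓝[<] τ₀, τ * ‖w‖ ≤ r := by
    filter_upwards [hev.filter_mono nhdsWithin_le_nhds, self_mem_nhdsWithin,
      (lt_mem_nhds hτpos).filter_mono nhdsWithin_le_nhds] with τ hτ hlt h0
    obtain ⟨ζ, hζ, hζeq⟩ := hτ
    have hζ' : ‖ζ‖ < r := hζ
    have hnorm : ‖τ • w‖ = τ * ‖w‖ := by rw [norm_smul, Real.norm_of_nonneg h0.le]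
    have hmem : ‖τ • w‖ < ρ := by
      rw [hnorm, ← hτw]
      exact mul_lt_mul_of_pos_right hlt hw0
    have := hinj (show ‖ζ‖ < ρ by rw [hr] at hζ'; linarith) hmem hζeq
    rw [← hnorm, ← this]
    exact hζ'.le
  have hlim : Filter.Tendsto (fun τ : ℝ => τ * ‖w‖) (𝓝[<] τ₀) (𝓝 (τ₀ * ‖w‖)) :=
    ((continuous_id.mul continuous_const).tendsto τ₀).mono_left nhdsWithin_le_nhds
  have := le_of_tendsto hlim hev'
  rw [hτw, hr] at this
  linarith

theorem IsTotallyRetractive.inv_spec {R : Retraction E M} {ρ : ℝ} {X : Set M} {p x y : M}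
    (h : IsTotallyRetractive R ρ X p) (hx : x ∈ X) (hy : y ∈ X) :
    ‖R.inv ρ x y‖ < ρ ∧ R x (R.inv ρ x y) = y := by
  have hex : ∃ ξ : TangentSpace 𝓘(ℝ, E) x, ‖ξ‖ < ρ ∧ R x ξ = y := (h.2 x hx).2.2 hy
  rw [Retraction.inv, dif_pos hex]
  exact hex.choose_spec

theorem IsTotallyRetractive.inv_self {R : Retraction E M} {ρ : ℝ} (hρ : 0 < ρ) {X : Set M}
    {p x : M} (h : IsTotallyRetractive R ρ X p) (hx : x ∈ X) : R.inv ρ x x = 0 := by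
  obtain ⟨h1, h2⟩ := h.inv_spec hx hx
  exact (h.2 x hx).1 h1 (by simpa using hρ) (h2.trans (R.map_zero x).symm)

theorem VectorTransport.between_self {R : Retraction E M} (T : VectorTransport R) {ρ : ℝ}
    (hρ : 0 < ρ) {X : Set M} {p x : M} (h : IsTotallyRetractive R ρ X p) (hx : x ∈ X)
    (v : TangentSpace 𝓘(ℝ, E) x) : T.between ρ x x v = v := by
  have hT : ∀ (ξ : TangentSpace 𝓘(ℝ, E) x) (e : R x ξ = x), ξ = 0 → e ▸ T.toFun x ξ v = v := by
    rintro _ e rfl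
    -- With a variable endpoint the cast along `e` can be eliminated.
    have key : ∀ (y : M) (e : y = x) (u : TangentSpace 𝓘(ℝ, E) y),
        (⟨y, u⟩ : TangentBundle 𝓘(ℝ, E) M) = ⟨x, v⟩ → e ▸ u = v := by
      rintro y rfl u hu
      cases hu
      rfl
    exact key _ e _ (T.map_zero x v)
  rw [VectorTransport.between, dif_pos (h.inv_spec hx hx).2]
  exact hT _ _ (h.inv_self hρ hx)

end Retractive

/-! ### Mean square inequalities -/

section MeanSquare

variable {Z : Type*} [MeasurableSpace Z] {D : Measure Z} [IsProbabilityMeasure D]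

theorem sq_integral_le {u : Z → ℝ} (hu : MemLp u 2 D) : (∫ z, u z ∂D) ^ 2 ≤ ∫ z, u z ^ 2 ∂D := by
  have h1 := ProbabilityTheory.variance_nonneg u D
  rw [ProbabilityTheory.variance_eq_sub hu] at h1
  simpa using h1

/-- Minkowski's inequality with a constant second summand; the cross term is controlled by the mean
of `u`, which is at most `a`. Only `u` needs integrability. -/
theorem integral_sq_le_of_le_add {u w : Z → ℝ} (hu : MemLp u 2 D) {a c : ℝ} (ha : 0 ≤ a)
    (hc : 0 ≤ c) (hua : ∫ z, u z ^ 2 ∂D ≤ a ^ 2) (hw0 : ∀ z, 0 ≤ w z) (hw : ∀ z, w z ≤ u z + c) :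
    ∫ z, w z ^ 2 ∂D ≤ (a + c) ^ 2 := by
  have hi : Integrable u D := hu.integrable (by norm_num)
  have hi2 : Integrable (fun z => u z ^ 2) D := hu.integrable_sq
  have hmean : ∫ z, u z ∂D ≤ a := by
    have := (sq_integral_le hu).trans hua
    exact (le_abs_self _).trans (abs_le_of_sq_le_sq this ha)
  have hint' : Integrable (fun z => 2 * c * u z + c ^ 2) D :=
    (hi.const_mul _).add (integrable_const _)
  have hint : Integrable (fun z => u z ^ 2 + (2 * c * u z + c ^ 2)) D := hi2.add hint'
  calc ∫ z, w z ^ 2 ∂D ≤ ∫ z, (u z ^ 2 + (2 * c * u z + c ^ 2)) ∂D := by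
        refine integral_mono_of_nonneg (ae_of_all _ fun z => sq_nonneg _) hint
          (ae_of_all _ fun z => ?_)
        have := pow_le_pow_left₀ (hw0 z) (hw z) 2
        simp only
        linarith
    _ = ∫ z, u z ^ 2 ∂D + (2 * c * ∫ z, u z ∂D + c ^ 2) := by
        rw [integral_add hi2 hint',
          integral_add (hi.const_mul _) (integrable_const _), integral_const_mul]
        simp
    _ ≤ (a + c) ^ 2 := by nlinarith [mul_le_mul_of_nonneg_left hmean hc]

end MeanSquare

/-! ### Vector transport of component gradients -/

section Transport

variable {E : Type*} [NormedAddCommGroup E] [NormedSpace ℝ E] [FiniteDimensional ℝ E]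
  {M : Type*} [EMetricSpace M] [ChartedSpace E M] [IsManifold 𝓘(ℝ, E) ∞ M]
  [RiemannianBundle (fun x : M => TangentSpace 𝓘(ℝ, E) x)]
  [IsContMDiffRiemannianBundle 𝓘(ℝ, E) ∞ E (fun x : M => TangentSpace 𝓘(ℝ, E) x)]
  {Z : Type*} [MeasurableSpace Z] {D : Measure Z} [IsProbabilityMeasure D]
  {R : Retraction E M} {T : VectorTransport R} {ρ : ℝ} {X : Set M} {xstar : M}
  {F : Z → M → ℝ} {G σ L Ll θ μ ν : ℝ}

/-- Passing through the parallel transport costs `Ll * ‖ξ‖` in mean square; replacing it by the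
vector transport costs at most `θ * ‖ξ‖ * G` pointwise. -/
theorem Assumptions.integral_transport_le (hA : Assumptions R T ρ X xstar D F G σ L Ll θ μ ν)
    (hU : UnbiasedOracle E X D F) {x : M} (hx : x ∈ X) {ξ : TangentSpace 𝓘(ℝ, E) x}
    (hξ : ‖ξ‖ < ρ) (hy : R x ξ ∈ X) :
    ∫ z, ‖grad E (F z) (R x ξ) - T.toFun x ξ (grad E (F z) x)‖ ^ 2 ∂D
      ≤ ((Ll + θ * G) * ‖ξ‖) ^ 2 := by
  obtain ⟨P', hP', hP'i⟩ := hA.lipschitz x hx ξ hξ hy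
  obtain ⟨P, hP, hPT⟩ := hA.transport_close x hx ξ hξ hy
  obtain ⟨-, hG, -, -, hLl, hθ, -, -⟩ := hA.pos
  -- The two assumptions supply transports in opposite directions along the same curve; this
  -- identity moves the Lipschitz bound to the endpoint.
  have hiso := hP.norm_sub_eq (R.continuous_smul x ξ) hP'
  have hcP : FiniteDimensional ℝ (TangentSpace 𝓘(ℝ, E) x) := ‹FiniteDimensional ℝ E›
  have hPc : Continuous P := P.continuous_of_finiteDimensional
  have hmeas : AEStronglyMeasurable (fun z => ‖P (grad E (F z) x) - grad E (F z) (R x ξ)‖) D :=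
    ((hPc.comp_aestronglyMeasurable (hU.measurable x hx)).sub (hU.measurable _ hy)).norm
  have hPnorm : ∀ v, ‖P v‖ = ‖v‖ := fun v => by simpa using hiso v 0
  have hmem : MemLp (fun z => ‖P (grad E (F z) x) - grad E (F z) (R x ξ)‖) 2 D := by
    refine MemLp.of_bound hmeas (G + G) (ae_of_all _ fun z => ?_)
    rw [norm_norm]
    refine (norm_sub_le _ _).trans (add_le_add ?_ (hA.grad_bound z _ hy))
    rw [hPnorm]
    exact hA.grad_bound z x hx
  rw [add_mul]
  refine integral_sq_le_of_le_add hmem (mul_nonneg hLl.le (norm_nonneg _))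
    (by positivity) ?_ (fun _ => norm_nonneg _) (fun z => ?_)
  · simp only [hiso, mul_pow]
    exact hP'i
  · have h1 : grad E (F z) (R x ξ) - T.toFun x ξ (grad E (F z) x)
        = -((P (grad E (F z) x) - grad E (F z) (R x ξ)) +
          (T.toFun x ξ (grad E (F z) x) - P (grad E (F z) x))) := by abel
    rw [h1, norm_neg]
    refine (norm_add_le _ _).trans (add_le_add le_rfl ((hPT _).trans ?_))
    rw [mul_right_comm]
    exact mul_le_mul_of_nonneg_right (mul_le_mul_of_nonneg_left (hA.grad_bound z x hx) hθ.le)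
      (norm_nonneg _)

/-- Between two points of `X` the vector transport is a linear isometry, and it moves the component
gradients into one another up to an error in mean square controlled by the distance. -/
theorem Assumptions.exists_transport (hA : Assumptions R T ρ X xstar D F G σ L Ll θ μ ν)
    (hU : UnbiasedOracle E X D F) {x y : M} (hx : x ∈ X) (hy : y ∈ X) :
    ∃ (U : TangentSpace 𝓘(ℝ, E) x →ₗᵢ[ℝ] TangentSpace 𝓘(ℝ, E) y) (r : ℝ), 0 ≤ r ∧
      (∀ v, T.between ρ x y v = U v) ∧ ENNReal.ofReal r ≤ ENNReal.ofReal μ * edist x y ∧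
      ∫ z, ‖grad E (F z) y - U (grad E (F z) x)‖ ^ 2 ∂D ≤ ((Ll + θ * G) * r) ^ 2 := by
  obtain ⟨h1, h2⟩ := hA.totallyRetractive.inv_spec hx hy
  have key : ∀ (ξ : TangentSpace 𝓘(ℝ, E) x) (y' : M) (e : R x ξ = y'), ‖ξ‖ < ρ → y' ∈ X →
      ∃ U : TangentSpace 𝓘(ℝ, E) x →ₗᵢ[ℝ] TangentSpace 𝓘(ℝ, E) y',
        (∀ v, (e ▸ T.toFun x ξ v : TangentSpace 𝓘(ℝ, E) y') = U v) ∧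
        ENNReal.ofReal ‖ξ‖ ≤ ENNReal.ofReal μ * edist x y' ∧
        ∫ z, ‖grad E (F z) y' - U (grad E (F z) x)‖ ^ 2 ∂D ≤ ((Ll + θ * G) * ‖ξ‖) ^ 2 := by
    rintro ξ _ rfl hξ hy'
    exact ⟨T.toFun x ξ, fun _ => rfl, (hA.distance x hx ξ hξ hy').1,
      hA.integral_transport_le hU hx hξ hy'⟩
  obtain ⟨U, hU1, hU2, hU3⟩ := key _ y h2 h1 hy
  refine ⟨U, _, norm_nonneg _, fun v => ?_, hU2, hU3⟩
  rw [VectorTransport.between, dif_pos h2]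
  exact hU1 v

theorem Assumptions.norm_grad_objective_le (hA : Assumptions R T ρ X xstar D F G σ L Ll θ μ ν)
    (hU : UnbiasedOracle E X D F) {x : M} (hx : x ∈ X) : ‖grad E (objective D F) x‖ ≤ G := by
  rw [← hU.unbiased x hx]
  simpa using norm_integral_le_of_norm_le_const (μ := D)
    (ae_of_all _ fun z => hA.grad_bound z x hx)

end Transport

/-! ### Borel measurability of gradient norms -/

section Semicontinuity

variable {E : Type*} [NormedAddCommGroup E] [NormedSpace ℝ E] [FiniteDimensional ℝ E]
  {M : Type*} [TopologicalSpace M] [ChartedSpace E M] [IsManifold 𝓘(ℝ, E) ∞ M]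
  [RiemannianBundle (fun x : M => TangentSpace 𝓘(ℝ, E) x)]

theorem inner_grad (f : M → ℝ) (x : M) (v : TangentSpace 𝓘(ℝ, E) x) :
    inner ℝ (grad E f x) v = mvfderiv 𝓘(ℝ, E) f x v := by
  have : FiniteDimensional ℝ (TangentSpace 𝓘(ℝ, E) x) := ‹FiniteDimensional ℝ E›
  have : CompleteSpace (TangentSpace 𝓘(ℝ, E) x) := FiniteDimensional.complete ℝ _
  exact InnerProductSpace.toDual_symm_apply

theorem continuous_mvfderiv {f : M → ℝ} (hf : ContMDiff 𝓘(ℝ, E) 𝓘(ℝ, ℝ) 2 f) :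
    Continuous fun p : TangentBundle 𝓘(ℝ, E) M => mvfderiv 𝓘(ℝ, E) f p.1 p.2 := by
  have h := hf.continuous_tangentMap (by norm_num)
  exact continuous_snd.comp ((tangentBundleModelSpaceHomeomorph 𝓘(ℝ, ℝ)).continuous.comp h)

variable [IsContMDiffRiemannianBundle 𝓘(ℝ, E) ∞ E (fun x : M => TangentSpace 𝓘(ℝ, E) x)]

theorem continuous_norm_sq :
    Continuous fun p : TangentBundle 𝓘(ℝ, E) M => ‖p.2‖ ^ 2 := by
  have : IsContinuousRiemannianBundle E (fun x : M => TangentSpace 𝓘(ℝ, E) x) := by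
    obtain ⟨g, hg, hg'⟩ := IsContMDiffRiemannianBundle.exists_contMDiff (IB := 𝓘(ℝ, E)) (n := ∞)
      (F := E) (E := fun x : M => TangentSpace 𝓘(ℝ, E) x)
    exact ⟨g, hg.continuous, hg'⟩
  have h : Continuous fun p : TangentBundle 𝓘(ℝ, E) M => (inner ℝ p.2 p.2 : ℝ) :=
    Continuous.inner_bundle (F := E) (E := fun x : M => TangentSpace 𝓘(ℝ, E) x)
      (b := fun p : TangentBundle 𝓘(ℝ, E) M => p.1) continuous_id continuous_id
  simpa only [real_inner_self_eq_norm_sq] using h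

/-- For `c ≥ 0`, `‖grad f x‖ > c` means `c‖v‖ < df(v)` for some `v` at `x`. Such `v` form an open
set of the tangent bundle, and the bundle projection is open. -/
theorem lowerSemicontinuous_norm_grad {f : M → ℝ} (hf : ContMDiff 𝓘(ℝ, E) 𝓘(ℝ, ℝ) 2 f) :
    LowerSemicontinuous fun x => ‖grad E f x‖ := by
  rw [lowerSemicontinuous_iff_isOpen_preimage]
  intro c
  rcases lt_or_ge c 0 with hc | hc
  · convert isOpen_univ
    exact Set.eq_univ_of_forall fun x => hc.trans_le (norm_nonneg _)
  have hK : IsOpen {p : TangentBundle 𝓘(ℝ, E) M |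
      c * √(‖p.2‖ ^ 2) < mvfderiv 𝓘(ℝ, E) f p.1 p.2} :=
    isOpen_lt (continuous_const.mul continuous_norm_sq.sqrt) (continuous_mvfderiv hf)
  convert FiberBundle.isOpenMap_proj E (TangentSpace 𝓘(ℝ, E) (M := M)) _ hK using 1
  ext x
  simp only [Set.mem_preimage, Set.mem_Ioi, Set.mem_image, Set.mem_ofPred_eq]
  constructor
  · intro hx
    refine ⟨⟨x, grad E f x⟩, ?_, rfl⟩
    rw [Real.sqrt_sq (norm_nonneg _), ← inner_grad, real_inner_self_eq_norm_sq, sq]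
    exact mul_lt_mul_of_pos_right hx (hc.trans_lt hx)
  · rintro ⟨⟨y, v⟩, hv, rfl⟩
    rw [Real.sqrt_sq (norm_nonneg _), ← inner_grad] at hv
    by_contra! hle
    exact absurd (real_inner_le_norm (grad E f y) v)
      (not_le.2 ((mul_le_mul_of_nonneg_right hle (norm_nonneg v)).trans_lt hv))

/-- The squared distance of a tangent vector to the gradient is a Borel function on the tangent
bundle. -/
theorem measurable_norm_sub_grad_sq {f : M → ℝ} (hf : ContMDiff 𝓘(ℝ, E) 𝓘(ℝ, ℝ) 2 f) :
    @Measurable (TangentBundle 𝓘(ℝ, E) M) ℝ (borel _) _ fun p => ‖p.2 - grad E f p.1‖ ^ 2 := by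
  borelize (TangentBundle 𝓘(ℝ, E) M)
  borelize M
  have hp : Measurable fun p : TangentBundle 𝓘(ℝ, E) M => p.1 :=
    (FiberBundle.continuous_proj E (TangentSpace 𝓘(ℝ, E) (M := M))).measurable
  have h1 := (lowerSemicontinuous_norm_grad hf).measurable.comp hp
  -- The cross term is the differential, which is continuous on the tangent bundle; only the last
  -- term needs semicontinuity.
  have h2 : (fun p : TangentBundle 𝓘(ℝ, E) M => ‖p.2 - grad E f p.1‖ ^ 2)
      = fun p => ‖p.2‖ ^ 2 - 2 * mvfderiv 𝓘(ℝ, E) f p.1 p.2 + ‖grad E f p.1‖ ^ 2 := by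
    funext p
    rw [@norm_sub_sq_real, real_inner_comm, inner_grad]
  rw [h2]
  exact (continuous_norm_sq.measurable.sub
    ((continuous_mvfderiv hf).measurable.const_mul 2)).add (h1.pow_const 2)

theorem measurable_norm_sq :
    @Measurable (TangentBundle 𝓘(ℝ, E) M) ℝ (borel _) _ fun p => ‖p.2‖ ^ 2 := by
  borelize (TangentBundle 𝓘(ℝ, E) M)
  exact continuous_norm_sq.measurable

theorem measurable_norm_grad_sq {f : M → ℝ} (hf : ContMDiff 𝓘(ℝ, E) 𝓘(ℝ, ℝ) 2 f) :
    @Measurable (TangentBundle 𝓘(ℝ, E) M) ℝ (borel _) _ fun p => ‖grad E f p.1‖ ^ 2 := by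
  borelize (TangentBundle 𝓘(ℝ, E) M)
  borelize M
  have hp : Measurable fun p : TangentBundle 𝓘(ℝ, E) M => p.1 :=
    (FiberBundle.continuous_proj E (TangentSpace 𝓘(ℝ, E) (M := M))).measurable
  exact ((lowerSemicontinuous_norm_grad hf).measurable.comp hp).pow_const 2

end Semicontinuity

/-! ### Mean square error of independent samples -/

section IndependentBatch

variable {Z : Type*} [MeasurableSpace Z] {D : Measure Z} [IsProbabilityMeasure D]

/-- Weights of sum 1 make the estimator unbiased, so the cross term with `a` vanishes, and variances
of independent terms add. Zero weights allow averages over an initial segment only. -/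
theorem integral_weighted_sum_sq {N : ℕ} {u : Z → ℝ} (hu : MemLp u 2 D) (w : Fin N → ℝ)
    (hw : ∑ j, w j = 1) (a : ℝ) :
    ∫ ζ : Fin N → Z, (∑ j, w j * u (ζ j) - ∫ z, u z ∂D + a) ^ 2 ∂(Measure.pi fun _ => D)
      = (∑ j, w j ^ 2) * ProbabilityTheory.variance u D + a ^ 2 := by
  set P : Measure (Fin N → Z) := Measure.pi fun _ => D with hP
  set m := ∫ z, u z ∂D with hm
  let S : (Fin N → Z) → ℝ := ∑ j, fun ζ => w j * u (ζ j)
  have hSapp : ∀ ζ, S ζ = ∑ j, w j * u (ζ j) := fun ζ => by simp [S]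
  have hmemj : ∀ j, MemLp (fun ζ : Fin N → Z => w j * u (ζ j)) 2 P := fun j =>
    (hu.comp_measurePreserving (measurePreserving_eval (fun _ : Fin N => D) j)).const_mul (w j)
  have hS : MemLp S 2 P := memLp_finsetSum' _ fun j _ => hmemj j
  have hvar : ProbabilityTheory.variance S P = (∑ j, w j ^ 2) * ProbabilityTheory.variance u D := by
    have := ProbabilityTheory.variance_sum_pi (μ := fun _ : Fin N => D)
      (X := fun j z => w j * u z) (fun j => hu.const_mul (w j))
    simp only [ProbabilityTheory.variance_const_mul, ← Finset.sum_mul] at this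
    exact this
  have hmean : ∫ ζ, S ζ ∂P = m := by
    simp only [hSapp]
    rw [integral_finsetSum _ fun j _ => (hmemj j).integrable (by norm_num)]
    simp only [integral_const_mul]
    have : ∀ j, ∫ ζ : Fin N → Z, u (ζ j) ∂P = m := fun j =>
      integral_comp_eval (μ := fun _ : Fin N => D) hu.aestronglyMeasurable
    simp only [this, ← Finset.sum_mul, hw, one_mul]
  have hSm : MemLp (fun ζ => S ζ - m) 2 P := hS.sub (memLp_const m)
  have hi1 : Integrable (fun ζ => (S ζ - m) ^ 2) P := hSm.integrable_sq
  have hi2 : Integrable (fun ζ => 2 * a * (S ζ - m)) P :=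
    (hSm.integrable (by norm_num)).const_mul _
  have hi3 : Integrable (fun ζ => 2 * a * (S ζ - m) + a ^ 2) P := hi2.add (integrable_const _)
  have hexp : ∀ ζ : Fin N → Z, (∑ j, w j * u (ζ j) - m + a) ^ 2
      = (S ζ - m) ^ 2 + (2 * a * (S ζ - m) + a ^ 2) := fun ζ => by rw [hSapp]; ring
  simp only [hexp]
  rw [integral_add hi1 hi3, integral_add hi2 (integrable_const _), integral_const_mul,
    integral_sub (hS.integrable (by norm_num)) (integrable_const _), hmean, ← hvar,
    ProbabilityTheory.variance_eq_integral hS.aestronglyMeasurable.aemeasurable, hmean]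
  simp

variable {H : Type*} [NormedAddCommGroup H] [InnerProductSpace ℝ H] [FiniteDimensional ℝ H]

/-- Apply the scalar identity to each coordinate in an orthonormal basis. -/
theorem integral_norm_weighted_sum_sq {N : ℕ} {Y : Z → H} (hY : MemLp Y 2 D) (w : Fin N → ℝ)
    (hw : ∑ j, w j = 1) (a : H) :
    ∫ ζ : Fin N → Z, ‖∑ j, w j • Y (ζ j) - ∫ z, Y z ∂D + a‖ ^ 2 ∂(Measure.pi fun _ => D)
      = (∑ j, w j ^ 2) * ∫ z, ‖Y z - ∫ z', Y z' ∂D‖ ^ 2 ∂D + ‖a‖ ^ 2 := by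
  have := FiniteDimensional.complete ℝ H
  let b := stdOrthonormalBasis ℝ H
  set m := ∫ z, Y z ∂D
  have hYi : Integrable Y D := hY.integrable (by norm_num)
  have hnorm : ∀ v : H, ‖v‖ ^ 2 = ∑ i, (inner ℝ (b i) v : ℝ) ^ 2 := fun v => by
    rw [← b.sum_sq_norm_inner_right v]
    simp
  have hu : ∀ i, MemLp (fun z => (inner ℝ (b i) (Y z) : ℝ)) 2 D := fun i => hY.const_inner (b i)
  have hm : ∀ i, (inner ℝ (b i) m : ℝ) = ∫ z, inner ℝ (b i) (Y z) ∂D := fun i =>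
    (integral_inner hYi (b i)).symm
  have hmem : ∀ i, MemLp (fun ζ : Fin N → Z => ∑ j, w j * (inner ℝ (b i) (Y (ζ j)) : ℝ)
      - ∫ z, inner ℝ (b i) (Y z) ∂D + inner ℝ (b i) a) 2 (Measure.pi fun _ => D) := fun i =>
    ((memLp_finsetSum _ fun j _ => ((hu i).comp_measurePreserving
      (measurePreserving_eval (fun _ : Fin N => D) j)).const_mul (w j)).sub
        (memLp_const _)).add (memLp_const _)
  have hmem' : ∀ i, MemLp (fun z => (inner ℝ (b i) (Y z) : ℝ) - ∫ z', inner ℝ (b i) (Y z') ∂D)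
      2 D := fun i => (hu i).sub (memLp_const _)
  simp only [hnorm, inner_add_right, inner_sub_right, inner_sum, inner_smul_right, hm]
  rw [integral_finsetSum _ fun i _ => (hmem i).integrable_sq, integral_finsetSum _ fun i _ =>
    (hmem' i).integrable_sq, Finset.mul_sum, ← Finset.sum_add_distrib]
  refine Finset.sum_congr rfl fun i _ => ?_
  rw [integral_weighted_sum_sq (hu i) w hw,
    ProbabilityTheory.variance_eq_integral (hu i).aestronglyMeasurable.aemeasurable]

/-- The mean square error of the average of the first `B` of `N` independent samples. -/
theorem lintegral_norm_average_sq {N B : ℕ} (hB : 0 < B) (hBN : B ≤ N) {Y : Z → H}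
    (hY : MemLp Y 2 D) (a : H) :
    ∫⁻ ζ : Fin N → Z, ENNReal.ofReal (‖(B : ℝ)⁻¹ • ∑ j : Fin N with j.val < B, Y (ζ j)
        - ∫ z, Y z ∂D + a‖ ^ 2) ∂(Measure.pi fun _ => D)
      = ENNReal.ofReal ((B : ℝ)⁻¹ * ∫ z, ‖Y z - ∫ z', Y z' ∂D‖ ^ 2 ∂D + ‖a‖ ^ 2) := by
  have hB0 : (B : ℝ) ≠ 0 := by positivity
  let w : Fin N → ℝ := fun j => if j.val < B then (B : ℝ)⁻¹ else 0
  have hcard : (Finset.univ.filter fun j : Fin N => j.val < B).card = B := by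
    rw [Fin.card_filter_val_lt, min_eq_right hBN]
  have hw1 : ∑ j, w j = 1 := by
    simp only [w, ← Finset.sum_filter, Finset.sum_const, hcard, nsmul_eq_mul]
    exact mul_inv_cancel₀ hB0
  have hw2 : ∑ j, w j ^ 2 = (B : ℝ)⁻¹ := by
    have : ∀ j : Fin N, w j ^ 2 = if j.val < B then (B : ℝ)⁻¹ ^ 2 else 0 := fun j => by
      simp only [w]; split_ifs <;> simp
    simp only [this, ← Finset.sum_filter, Finset.sum_const, hcard, nsmul_eq_mul]
    field_simp
  have hsum : ∀ ζ : Fin N → Z, (B : ℝ)⁻¹ • ∑ j : Fin N with j.val < B, Y (ζ j)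
      = ∑ j, w j • Y (ζ j) := fun ζ => by
    rw [Finset.smul_sum, Finset.sum_filter]
    refine Finset.sum_congr rfl fun j _ => ?_
    simp only [w]; split_ifs <;> simp
  have hint : MemLp (fun ζ : Fin N → Z => ∑ j, w j • Y (ζ j) - ∫ z, Y z ∂D + a) 2
      (Measure.pi fun _ => D) :=
    ((memLp_finsetSum _ fun j _ => (hY.comp_measurePreserving
      (measurePreserving_eval (fun _ : Fin N => D) j)).const_smul (w j)).sub
        (memLp_const _)).add (memLp_const _)
  simp only [hsum]
  rw [← ofReal_integral_eq_lintegral_ofReal hint.norm.integrable_sq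
    (ae_of_all _ fun _ => sq_nonneg _), integral_norm_weighted_sum_sq hY w hw1, hw2]

theorem integral_norm_sub_integral_sq_le {Y : Z → H} (hY : MemLp Y 2 D) :
    ∫ z, ‖Y z - ∫ z', Y z' ∂D‖ ^ 2 ∂D ≤ ∫ z, ‖Y z‖ ^ 2 ∂D := by
  have := FiniteDimensional.complete ℝ H
  set m := ∫ z, Y z ∂D
  have hYi : Integrable Y D := hY.integrable (by norm_num)
  have h2 : Integrable (fun z => 2 * (inner ℝ m (Y z) : ℝ)) D := (hYi.const_inner m).const_mul 2
  have h1 : Integrable (fun z => ‖Y z‖ ^ 2) D := hY.norm.integrable_sq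
  have h3 : Integrable (fun z => ‖Y z‖ ^ 2 - 2 * (inner ℝ m (Y z) : ℝ)) D := h1.sub h2
  have : ∀ z, ‖Y z - m‖ ^ 2 = ‖Y z‖ ^ 2 - 2 * inner ℝ m (Y z) + ‖m‖ ^ 2 := fun z => by
    rw [@norm_sub_sq_real, real_inner_comm]
  simp only [this]
  rw [integral_add h3 (integrable_const _), integral_sub h1 h2, integral_const_mul,
    integral_inner hYi, real_inner_self_eq_norm_sq]
  simp only [integral_const, probReal_univ, one_smul]
  nlinarith [sq_nonneg ‖m‖]

end IndependentBatch

/-! ### Sampling without replacement -/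

section WithoutReplacement

variable {H : Type*} [NormedAddCommGroup H] [InnerProductSpace ℝ H]

/-- Draws from a centred population are negatively correlated: for fixed `j` the sums over all `k'`
add up to zero, the diagonal one is nonnegative, and the others are equal by symmetry. -/
theorem sum_perm_inner_nonpos {n : ℕ} {Y : Fin n → H} (hY : ∑ i, Y i = 0) {j k : Fin n}
    (hjk : j ≠ k) : ∑ σ : Equiv.Perm (Fin n), (inner ℝ (Y (σ j)) (Y (σ k)) : ℝ) ≤ 0 := by
  have hsymm : ∀ k' ∈ Finset.univ.erase j,
      ∑ σ : Equiv.Perm (Fin n), (inner ℝ (Y (σ j)) (Y (σ k')) : ℝ)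
        = ∑ σ : Equiv.Perm (Fin n), (inner ℝ (Y (σ j)) (Y (σ k)) : ℝ) := by
    intro k' hk'
    have hk'j : j ≠ k' := (Finset.ne_of_mem_erase hk').symm
    -- This swap fixes `j`, so it exchanges only the second index.
    refine Fintype.sum_equiv (Equiv.mulRight (Equiv.swap k k')) _ _ fun σ => ?_
    simp [Equiv.swap_apply_of_ne_of_ne hjk hk'j]
  have hzero : ∑ k', ∑ σ : Equiv.Perm (Fin n), (inner ℝ (Y (σ j)) (Y (σ k')) : ℝ) = 0 := by
    rw [Finset.sum_comm]
    refine Finset.sum_eq_zero fun σ _ => ?_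
    rw [← inner_sum, Equiv.sum_comp σ Y, hY, inner_zero_right]
  rw [← Finset.add_sum_erase _ _ (Finset.mem_univ j), Finset.sum_congr rfl hsymm,
    Finset.sum_const, nsmul_eq_mul] at hzero
  have hdiag : 0 ≤ ∑ σ : Equiv.Perm (Fin n), (inner ℝ (Y (σ j)) (Y (σ j)) : ℝ) :=
    Finset.sum_nonneg fun σ _ => real_inner_self_nonneg
  have hpos : 0 < (((Finset.univ : Finset (Fin n)).erase j).card : ℝ) := by
    exact_mod_cast Finset.card_pos.2 ⟨k, Finset.mem_erase.2 ⟨hjk.symm, Finset.mem_univ _⟩⟩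
  by_contra! hlt
  nlinarith [mul_pos hpos hlt]

theorem sum_perm_norm_sq {n : ℕ} (Y : Fin n → H) (j : Fin n) :
    (n : ℝ) * ∑ σ : Equiv.Perm (Fin n), ‖Y (σ j)‖ ^ 2
      = (Fintype.card (Equiv.Perm (Fin n)) : ℝ) * ∑ i, ‖Y i‖ ^ 2 := by
  have hsymm : ∀ k, ∑ σ : Equiv.Perm (Fin n), ‖Y (σ k)‖ ^ 2
      = ∑ σ : Equiv.Perm (Fin n), ‖Y (σ j)‖ ^ 2 := fun k =>
    Fintype.sum_equiv (Equiv.mulRight (Equiv.swap j k)) _ _ fun σ => by simp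
  have h1 : ∑ k, ∑ σ : Equiv.Perm (Fin n), ‖Y (σ k)‖ ^ 2
      = n * ∑ σ : Equiv.Perm (Fin n), ‖Y (σ j)‖ ^ 2 := by
    simp [hsymm]
  rw [← h1, Finset.sum_comm]
  have : ∀ σ : Equiv.Perm (Fin n), ∑ k, ‖Y (σ k)‖ ^ 2 = ∑ i, ‖Y i‖ ^ 2 := fun σ =>
    Equiv.sum_comp σ fun i => ‖Y i‖ ^ 2
  simp [this]

/-- Sampling without replacement does not increase the mean square error. -/
theorem sum_perm_norm_sum_sq_le {n : ℕ} {Y : Fin n → H} (hY : ∑ i, Y i = 0)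
    (J : Finset (Fin n)) :
    (n : ℝ) * ∑ σ : Equiv.Perm (Fin n), ‖∑ j ∈ J, Y (σ j)‖ ^ 2
      ≤ J.card * ((Fintype.card (Equiv.Perm (Fin n)) : ℝ) * ∑ i, ‖Y i‖ ^ 2) := by
  have hexp : ∀ σ : Equiv.Perm (Fin n), ‖∑ j ∈ J, Y (σ j)‖ ^ 2
      = ∑ j ∈ J, ∑ k ∈ J, (inner ℝ (Y (σ j)) (Y (σ k)) : ℝ) := fun σ => by
    rw [← real_inner_self_eq_norm_sq, sum_inner]
    simp only [inner_sum]
  have hle : ∑ σ : Equiv.Perm (Fin n), ‖∑ j ∈ J, Y (σ j)‖ ^ 2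
      ≤ ∑ j ∈ J, ∑ σ : Equiv.Perm (Fin n), ‖Y (σ j)‖ ^ 2 := by
    simp only [hexp]
    rw [Finset.sum_comm]
    refine Finset.sum_le_sum fun j hj => ?_
    rw [Finset.sum_comm, ← Finset.add_sum_erase _ _ hj]
    simp only [real_inner_self_eq_norm_sq]
    have := Finset.sum_nonpos (s := J.erase j) (f := fun k => ∑ σ : Equiv.Perm (Fin n),
      (inner ℝ (Y (σ j)) (Y (σ k)) : ℝ)) fun k hk =>
        sum_perm_inner_nonpos hY (Finset.ne_of_mem_erase hk).symm
    linarith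
  calc (n : ℝ) * ∑ σ : Equiv.Perm (Fin n), ‖∑ j ∈ J, Y (σ j)‖ ^ 2
      ≤ n * ∑ j ∈ J, ∑ σ : Equiv.Perm (Fin n), ‖Y (σ j)‖ ^ 2 :=
        mul_le_mul_of_nonneg_left hle (Nat.cast_nonneg _)
    _ = _ := by
        rw [Finset.mul_sum, Finset.sum_congr rfl fun j _ => sum_perm_norm_sq Y j,
          Finset.sum_const, nsmul_eq_mul]

theorem lintegral_orderingLaw {n : ℕ} (h : (Fin n → Fin n) → ENNReal) :
    ∫⁻ g, h g ∂(orderingLaw n)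
      = (Fintype.card (Equiv.Perm (Fin n)) : ENNReal)⁻¹ * ∑ σ : Equiv.Perm (Fin n), h σ := by
  classical
  have hs : {g : Fin n → Fin n | Function.Injective g}
      = ↑(Finset.univ.image fun σ : Equiv.Perm (Fin n) => (σ : Fin n → Fin n)) := by
    ext g
    simp only [Set.mem_ofPred_eq, Finset.coe_image, Finset.coe_univ, Set.image_univ, Set.mem_range]
    exact ⟨fun hg => ⟨Equiv.ofBijective g (Finite.injective_iff_bijective.1 hg), rfl⟩,
      fun ⟨σ, hσ⟩ => hσ ▸ σ.injective⟩
  have hinj : Function.Injective fun σ : Equiv.Perm (Fin n) => (σ : Fin n → Fin n) :=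
    DFunLike.coe_injective
  rw [orderingLaw, ProbabilityTheory.uniformOn, ProbabilityTheory.cond, lintegral_smul_measure, hs,
    Measure.count_apply_finset, Finset.card_image_of_injective _ hinj, Finset.card_univ,
    lintegral_finset, Finset.sum_image hinj.injOn]
  simp

end WithoutReplacement

/-! ### Resampling in product measures -/

section Resampling

variable {ι : Type*} [Fintype ι] [DecidableEq ι] {Ω : ι → Type*} [∀ i, MeasurableSpace (Ω i)]
  {P : ∀ i, Measure (Ω i)} [∀ i, IsProbabilityMeasure (P i)]

theorem measurePreserving_update (i : ι) :
    MeasurePreserving (fun p : (∀ i, Ω i) × Ω i => Function.update p.1 i p.2)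
      ((Measure.pi P).prod (P i)) (Measure.pi P) := by
  have hmeas : Measurable fun p : (∀ i, Ω i) × Ω i => Function.update p.1 i p.2 := by
    refine measurable_pi_lambda _ fun j => ?_
    by_cases hj : j = i
    · subst hj
      simpa using measurable_snd
    · simpa [Function.update_of_ne hj, Function.comp_def] using
        (measurable_pi_apply j).comp measurable_fst
  refine ⟨hmeas, (Measure.pi_eq fun s hs => ?_).symm⟩
  rw [Measure.map_apply hmeas (MeasurableSet.univ_pi hs)]
  -- The overwritten coordinate is unconstrained and contributes the factor `P i univ = 1`.
  have hpre : (fun p : (∀ i, Ω i) × Ω i => Function.update p.1 i p.2) ⁻¹' Set.univ.pi s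
      = Set.univ.pi (Function.update s i Set.univ) ×ˢ s i := by
    ext p
    simp only [Set.mem_preimage, Set.mem_pi, Set.mem_univ, true_implies, Set.mem_prod]
    constructor
    · intro h
      refine ⟨fun j => ?_, by simpa using h i⟩
      by_cases hj : j = i
      · subst hj
        simp
      · simpa [Function.update_of_ne hj] using h j
    · rintro ⟨h1, h2⟩ j
      by_cases hj : j = i
      · subst hj
        simpa using h2
      · simpa [Function.update_of_ne hj] using h1 j
  rw [hpre, Measure.prod_prod, Measure.pi_pi, ← Finset.mul_prod_erase _ _ (Finset.mem_univ i),
    ← Finset.mul_prod_erase Finset.univ (fun j => P j (s j)) (Finset.mem_univ i)]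
  simp only [Function.update_self, measure_univ, one_mul]
  rw [mul_comm]
  congr 1
  refine Finset.prod_congr rfl fun j hj => ?_
  rw [Function.update_of_ne (Finset.ne_of_mem_erase hj)]

/-- Allows only a part of a coordinate to be refreshed: here a coordinate is a whole epoch, while
one batch or mini-batch is redrawn. -/
theorem measurePreserving_update_comp (i : ι) {A : Type*} [MeasurableSpace A] {κ : Measure A}
    [IsProbabilityMeasure κ] {r : Ω i × A → Ω i}
    (hr : MeasurePreserving r ((P i).prod κ) (P i)) :
    MeasurePreserving (fun p : (∀ i, Ω i) × A => Function.update p.1 i (r (p.1 i, p.2)))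
      ((Measure.pi P).prod κ) (Measure.pi P) := by
  have hmeas : Measurable
      fun p : (∀ i, Ω i) × A => Function.update p.1 i (r (p.1 i, p.2)) :=
    (measurePreserving_update (P := P) i).measurable.comp (measurable_fst.prodMk
      (hr.measurable.comp (((measurable_pi_apply i).comp measurable_fst).prodMk measurable_snd)))
  refine ⟨hmeas, ?_⟩
  -- Refreshing coordinate `i` beforehand changes no law. After that, `r` acts on an independent
  -- copy of it, which is the map treated in `h2`.
  have h1 := (measurePreserving_update (P := P) i).prod (MeasurePreserving.id κ)
  have h2 := (measurePreserving_update (P := P) i).comp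
    (((MeasurePreserving.id (Measure.pi P)).prod hr).comp
      (measurePreserving_prodAssoc (Measure.pi P) (P i) κ))
  have h3 : Measure.map (fun p : (∀ i, Ω i) × A => Function.update p.1 i (r (p.1 i, p.2)))
      (Measure.map (Prod.map (fun p : (∀ i, Ω i) × Ω i => Function.update p.1 i p.2) id)
        (((Measure.pi P).prod (P i)).prod κ)) = Measure.pi P := by
    rw [Measure.map_map hmeas h1.measurable]
    refine Eq.trans ?_ h2.map_eq
    congr 1
    funext p
    simp [Function.comp, MeasurableEquiv.prodAssoc]
  rwa [h1.map_eq] at h3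

end Resampling

section ResamplingEpoch

/-- Plays the role of the tower property: a bound on the average over the fresh block, for almost
every fixed sample, integrates. The bound `g` may depend on the whole sample, including the block
being replaced. -/
theorem lintegral_le_of_resample {Ω A : Type*} [MeasurableSpace Ω] [MeasurableSpace A]
    {P : Measure Ω} {κ : Measure A} [SFinite κ] {Φ : Ω × A → Ω}
    (hΦ : MeasurePreserving Φ (P.prod κ) P) {h g : Ω → ENNReal} (hh : Measurable h)
    (hle : ∀ᵐ x ∂P, ∫⁻ a, h (Φ (x, a)) ∂κ ≤ g x) : ∫⁻ x, h x ∂P ≤ ∫⁻ x, g x ∂P := by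
  rw [← hΦ.lintegral_comp hh, lintegral_prod (fun p => h (Φ p)) (hh.comp hΦ.measurable).aemeasurable]
  exact lintegral_mono_ae hle

variable {Z : Type*} [MeasurableSpace Z] {S m b N : ℕ} {D : Measure Z} [IsProbabilityMeasure D]
  {Q : Measure (Fin N → Z)} [IsProbabilityMeasure Q]

/-- Replace the mini-batch of iteration `t` of epoch `s`. -/
def resampleMiniBatch (s : Fin S) (t : Fin m) (p : Samples S m b N Z × (Fin b → Z)) :
    Samples S m b N Z :=
  Function.update p.1 s ((p.1 s).1, Function.update (p.1 s).2 t p.2)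

/-- Replace the batch of epoch `s`. -/
def resampleBatch (s : Fin S) (p : Samples S m b N Z × (Fin N → Z)) : Samples S m b N Z :=
  Function.update p.1 s (p.2, (p.1 s).2)

theorem measurePreserving_resampleMiniBatch (s : Fin S) (t : Fin m) :
    MeasurePreserving (resampleMiniBatch (b := b) (N := N) (Z := Z) s t)
      ((sampleLaw S m b N Q D).prod (Measure.pi fun _ => D)) (sampleLaw S m b N Q D) :=
  measurePreserving_update_comp (P := fun _ : Fin S => Q.prod (Measure.pi fun _ : Fin m =>
      Measure.pi fun _ : Fin b => D)) s
    (r := fun q => (q.1.1, Function.update q.1.2 t q.2))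
    (((MeasurePreserving.id Q).prod (measurePreserving_update
      (P := fun _ : Fin m => Measure.pi fun _ : Fin b => D) t)).comp
        (measurePreserving_prodAssoc _ _ _))

theorem measurePreserving_resampleBatch (s : Fin S) :
    MeasurePreserving (resampleBatch (m := m) (b := b) (N := N) (Z := Z) s)
      ((sampleLaw S m b N Q D).prod Q) (sampleLaw S m b N Q D) :=
  measurePreserving_update_comp (P := fun _ : Fin S => Q.prod (Measure.pi fun _ : Fin m =>
      Measure.pi fun _ : Fin b => D)) s
    (r := fun q => (q.2, q.1.2))
    (Measure.measurePreserving_swap.comp ((measurePreserving_snd (μ := Q)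
      (ν := Measure.pi fun _ : Fin m => Measure.pi fun _ : Fin b => D)).prod
        (MeasurePreserving.id Q)))

end ResamplingEpoch

theorem sum_castSucc_sub_succ {m : ℕ} (g : Fin (m + 1) → ℝ) :
    ∑ t : Fin m, (g t.castSucc - g t.succ) = g 0 - g (Fin.last m) := by
  have h1 := Fin.sum_univ_succ g
  have h2 := Fin.sum_univ_castSucc g
  rw [Finset.sum_sub_distrib]
  linarith

/-- The descent inequality with `ξ = -ηv`, multiplied by `2/η`, after polarising `⟪g, v⟫`. -/
theorem norm_sq_add_le_of_descent {V : Type*} [NormedAddCommGroup V] [InnerProductSpace ℝ V]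
    {g v : V} {η L a b : ℝ} (hη : 0 < η)
    (h : b ≤ a + inner ℝ g (-(η • v)) + L / 2 * ‖-(η • v)‖ ^ 2) :
    ‖g‖ ^ 2 + (1 - L * η) * ‖v‖ ^ 2 ≤ 2 / η * (a - b) + ‖v - g‖ ^ 2 := by
  rw [inner_neg_right, real_inner_smul_right, norm_neg, norm_smul, Real.norm_of_nonneg hη.le] at h
  rw [@norm_sub_sq_real, real_inner_comm]
  have h2 : 2 / η * (η * inner ℝ g v - L / 2 * (η * ‖v‖) ^ 2) ≤ 2 / η * (a - b) :=
    mul_le_mul_of_nonneg_left (by linarith) (by positivity)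
  have h3 : 2 / η * (η * inner ℝ g v - L / 2 * (η * ‖v‖) ^ 2)
      = 2 * inner ℝ g v - L * η * ‖v‖ ^ 2 := by
    field_simp
  linarith

/-! ### Which samples an iterate depends on -/

section Run

variable {E : Type*} [NormedAddCommGroup E] [NormedSpace ℝ E] [FiniteDimensional ℝ E]
  {M : Type*} [TopologicalSpace M] [ChartedSpace E M] [IsManifold 𝓘(ℝ, E) ∞ M]
  [RiemannianBundle (fun x : M => TangentSpace 𝓘(ℝ, E) x)]
  {Z : Type*} {R : Retraction E M} (T : VectorTransport R) (ρ : ℝ) (F : Z → M → ℝ)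

theorem innerIterate_zero {m b : ℕ} (η : ℝ) (x₀ : M) (v₀ : TangentSpace 𝓘(ℝ, E) x₀)
    (I : Fin m → Fin b → Z) : innerIterate T ρ F η x₀ v₀ I 0 = x₀ := rfl

theorem innerIterate_succ {m b : ℕ} (η : ℝ) (x₀ : M) (v₀ : TangentSpace 𝓘(ℝ, E) x₀)
    (I : Fin m → Fin b → Z) (t : Fin m) :
    innerIterate T ρ F η x₀ v₀ I t.succ = R (innerIterate T ρ F η x₀ v₀ I t.castSucc)
      (-(η • modifiedGrad T ρ F x₀ v₀ (I t) (innerIterate T ρ F η x₀ v₀ I t.castSucc))) := by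
  simp only [innerIterate, Fin.induction_succ]
  rfl

/-- Causality: an iterate depends only on earlier mini-batches, so redrawing the current one leaves
it fixed. -/
theorem innerIterate_congr {m b : ℕ} (η : ℝ) (x₀ : M) (v₀ : TangentSpace 𝓘(ℝ, E) x₀)
    {I I' : Fin m → Fin b → Z} (t : Fin (m + 1)) (h : ∀ k : Fin m, k.castSucc < t → I k = I' k) :
    innerIterate T ρ F η x₀ v₀ I t = innerIterate T ρ F η x₀ v₀ I' t := by
  induction t using Fin.induction with
  | zero => rfl
  | succ t ih =>
    rw [innerIterate_succ, innerIterate_succ,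
      ih fun k hk => h k (hk.trans (Fin.castSucc_lt_succ (i := t))),
      h t (Fin.castSucc_lt_succ (i := t))]

variable (A : Input M) {N : ℕ}

theorem epochState_succ (smp : Samples A.S A.m A.b N Z) (s : Fin A.S) :
    epochState T ρ F A smp s.succ =
      (innerIterate T ρ F A.η (snapshot T ρ F A smp s) (snapshotGrad T ρ F A smp s) (smp s).2
        (Fin.last A.m), ∑ t : Fin A.m, ‖direction T ρ F A smp s t‖ ^ 2 / A.m) := by
  simp only [epochState, Fin.induction_succ]
  rfl

theorem epochState_congr {smp smp' : Samples A.S A.m A.b N Z} (s : Fin (A.S + 1))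
    (h : ∀ k : Fin A.S, k.castSucc < s → smp k = smp' k) :
    epochState T ρ F A smp s = epochState T ρ F A smp' s := by
  induction s using Fin.induction with
  | zero => rfl
  | succ s ih =>
    have h1 := ih fun k hk => h k (hk.trans (Fin.castSucc_lt_succ (i := s)))
    have h2 := h s (Fin.castSucc_lt_succ (i := s))
    simp only [epochState, Fin.induction_succ] at h1 ⊢
    rw [h1, h2]

theorem epochState_update (smp : Samples A.S A.m A.b N Z) (s : Fin A.S)
    (q : (Fin N → Z) × (Fin A.m → Fin A.b → Z)) :
    epochState T ρ F A (Function.update smp s q) s.castSucc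
      = epochState T ρ F A smp s.castSucc :=
  epochState_congr T ρ F A _ fun _ hk =>
    Function.update_of_ne (fun h => (h ▸ hk).ne rfl) _ _

/-- The squared error of the modified gradient in iteration `t` of an epoch started from the state
`st` with batch `ζ` and mini-batches `I`. -/
def errorSq (f : M → ℝ) (st : M × ℝ) (ζ : Fin N → Z) (I : Fin A.m → Fin A.b → Z) (t : Fin A.m) : ℝ :=
  let x := innerIterate T ρ F A.η st.1 (batchGrad F (A.batchSize st.2) ζ st.1) I t.castSucc
  ‖modifiedGrad T ρ F st.1 (batchGrad F (A.batchSize st.2) ζ st.1) (I t) x - grad E f x‖ ^ 2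

theorem errorSq_update (f : M → ℝ) (st : M × ℝ) (ζ : Fin N → Z) (I : Fin A.m → Fin A.b → Z)
    (t : Fin A.m) (J : Fin A.b → Z) :
    errorSq T ρ F A f st ζ (Function.update I t J) t =
      ‖modifiedGrad T ρ F st.1 (batchGrad F (A.batchSize st.2) ζ st.1) J
          (innerIterate T ρ F A.η st.1 (batchGrad F (A.batchSize st.2) ζ st.1) I t.castSucc)
        - grad E f
          (innerIterate T ρ F A.η st.1 (batchGrad F (A.batchSize st.2) ζ st.1) I t.castSucc)‖ ^ 2 := by
  have h := innerIterate_congr T ρ F A.η st.1 (batchGrad F (A.batchSize st.2) ζ st.1)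
    (I := Function.update I t J) (I' := I) t.castSucc fun k hk =>
      Function.update_of_ne (fun e => (e ▸ hk).ne rfl) _ _
  simp only [errorSq]
  rw [h, Function.update_self]

theorem errorSq_resampleMiniBatch (f : M → ℝ) (smp : Samples A.S A.m A.b N Z) (s : Fin A.S)
    (t : Fin A.m) (J : Fin A.b → Z) :
    ‖direction T ρ F A (resampleMiniBatch s t (smp, J)) s t
        - grad E f (iterate T ρ F A (resampleMiniBatch s t (smp, J)) s t)‖ ^ 2
      = ‖modifiedGrad T ρ F (snapshot T ρ F A smp s) (snapshotGrad T ρ F A smp s) J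
          (iterate T ρ F A smp s t) - grad E f (iterate T ρ F A smp s t)‖ ^ 2 := by
  -- As a real function of the epoch's state, the error can be rewritten along equalities of states
  -- without casts of tangent vectors.
  change errorSq T ρ F A f (epochState T ρ F A (Function.update smp s _) s.castSucc)
    (Function.update smp s _ s).1 (Function.update smp s _ s).2 t = _
  rw [epochState_update, Function.update_self]
  exact errorSq_update ..

theorem errorSq_resampleBatch (f : M → ℝ) (smp : Samples A.S A.m A.b N Z) (s : Fin A.S)
    (t : Fin A.m) (ht : t.val = 0) (ζ : Fin N → Z) :
    ‖direction T ρ F A (resampleBatch s (smp, ζ)) s t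
        - grad E f (iterate T ρ F A (resampleBatch s (smp, ζ)) s t)‖ ^ 2
      = ‖modifiedGrad T ρ F (snapshot T ρ F A smp s)
          (batchGrad F (A.batchSize (epochState T ρ F A smp s.castSucc).2) ζ
            (snapshot T ρ F A smp s)) ((smp s).2 t) (snapshot T ρ F A smp s)
          - grad E f (snapshot T ρ F A smp s)‖ ^ 2 := by
  change errorSq T ρ F A f (epochState T ρ F A (Function.update smp s _) s.castSucc)
    (Function.update smp s _ s).1 (Function.update smp s _ s).2 t = _
  rw [epochState_update, Function.update_self]
  have h0 : innerIterate T ρ F A.η (epochState T ρ F A smp s.castSucc).1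
      (batchGrad F (A.batchSize (epochState T ρ F A smp s.castSucc).2) ζ
        (epochState T ρ F A smp s.castSucc).1) (smp s).2 t.castSucc = snapshot T ρ F A smp s := by
    rw [show t.castSucc = 0 from Fin.ext ht, innerIterate_zero, snapshot]
  exact congrArg (fun x => ‖modifiedGrad T ρ F (snapshot T ρ F A smp s)
      (batchGrad F (A.batchSize (epochState T ρ F A smp s.castSucc).2) ζ
        (snapshot T ρ F A smp s)) ((smp s).2 t) x - grad E f x‖ ^ 2) h0

theorem iterate_eq_snapshot (smp : Samples A.S A.m A.b N Z) (s : Fin A.S) (t : Fin A.m)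
    (ht : t.val = 0) : iterate T ρ F A smp s t = snapshot T ρ F A smp s := by
  have h0 : t.castSucc = 0 := Fin.ext ht
  rw [iterate, h0, innerIterate_zero]

end Run

/-! ### Descent along a run that stays in `X` -/

section Descent

variable {E : Type*} [NormedAddCommGroup E] [NormedSpace ℝ E] [FiniteDimensional ℝ E]
  {M : Type*} [EMetricSpace M] [ChartedSpace E M] [IsManifold 𝓘(ℝ, E) ∞ M]
  [RiemannianBundle (fun x : M => TangentSpace 𝓘(ℝ, E) x)]
  {Z : Type*} [MeasurableSpace Z] {D : Measure Z} [IsProbabilityMeasure D]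
  {R : Retraction E M} {T : VectorTransport R} {ρ : ℝ} {X : Set M} {xstar : M}
  {F : Z → M → ℝ} {G σ L Ll θ μ ν : ℝ}

theorem norm_batchGrad_le (hG : ∀ z, ∀ x ∈ X, ‖grad E (F z) x‖ ≤ G) {N : ℕ} (B : ℕ)
    (ζ : Fin N → Z) {x : M} (hx : x ∈ X) (hG0 : 0 ≤ G) : ‖batchGrad (E := E) F B ζ x‖ ≤ G := by
  rw [batchGrad, norm_smul]
  have h1 : ‖∑ j : Fin N with j.val < B, grad E (F (ζ j)) x‖ ≤ B * G := by
    refine (norm_sum_le_of_le _ fun j _ => hG (ζ j) x hx).trans ?_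
    rw [Finset.sum_const, Fin.card_filter_val_lt, nsmul_eq_mul]
    exact mul_le_mul_of_nonneg_right (by exact_mod_cast min_le_right _ _) hG0
  rcases Nat.eq_zero_or_pos B with rfl | hB
  · simpa using hG0
  · rw [norm_inv, Real.norm_natCast, inv_mul_le_iff₀ (by positivity)]
    exact h1

variable {A : Input M} {N : ℕ} {smp : Samples A.S A.m A.b N Z}

theorem StaysIn.iterate_mem (h : StaysIn T ρ F A smp X) (s : Fin A.S) (t : Fin A.m) :
    iterate T ρ F A smp s t ∈ X := by
  have := h s t 0 (by simp)
  simpa [R.map_zero] using this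

theorem StaysIn.step_mem (h : StaysIn T ρ F A smp X) (s : Fin A.S) (t : Fin A.m) :
    R (iterate T ρ F A smp s t) (-(A.η • direction T ρ F A smp s t)) ∈ X := by
  simpa using h s t 1 (by simp)

/-- This is where continuous containment matters: endpoints in `X` alone would not bound the length
of the step. -/
theorem StaysIn.step_lt (hρ : 0 < ρ) (hX : IsTotallyRetractive R ρ X xstar)
    (h : StaysIn T ρ F A smp X) (s : Fin A.S) (t : Fin A.m) :
    ‖-(A.η • direction T ρ F A smp s t)‖ < ρ := by
  refine hX.norm_lt hρ (h.iterate_mem s t) fun τ hτ => ?_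
  rw [smul_neg, smul_smul]
  exact h s t τ hτ

/-- The iterates `x_0^s, …, x_m^s` of epoch `s`. -/
def point (T : VectorTransport R) (ρ : ℝ) (F : Z → M → ℝ) (A : Input M)
    (smp : Samples A.S A.m A.b N Z) (s : Fin A.S) : Fin (A.m + 1) → M :=
  innerIterate T ρ F A.η (snapshot T ρ F A smp s) (snapshotGrad T ρ F A smp s) (smp s).2

theorem point_succ (s : Fin A.S) (t : Fin A.m) : point T ρ F A smp s t.succ
    = R (iterate T ρ F A smp s t) (-(A.η • direction T ρ F A smp s t)) :=
  innerIterate_succ ..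

theorem StaysIn.snapshot_mem (h : StaysIn T ρ F A smp X) (hm : 0 < A.m) (s : Fin A.S) :
    snapshot T ρ F A smp s ∈ X := by
  rw [← iterate_eq_snapshot T ρ F A smp s ⟨0, hm⟩ rfl]
  exact h.iterate_mem s _

theorem StaysIn.descent (hA : Assumptions R T ρ X xstar D F G σ L Ll θ μ ν) (hη : 0 < A.η)
    (h : StaysIn T ρ F A smp X) (s : Fin A.S) (t : Fin A.m) :
    ‖grad E (objective D F) (iterate T ρ F A smp s t)‖ ^ 2
        + (1 - L * A.η) * ‖direction T ρ F A smp s t‖ ^ 2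
      ≤ 2 / A.η * (objective D F (point T ρ F A smp s t.castSucc)
          - objective D F (point T ρ F A smp s t.succ))
        + ‖direction T ρ F A smp s t - grad E (objective D F) (iterate T ρ F A smp s t)‖ ^ 2 := by
  have h1 := hA.smooth _ (h.iterate_mem s t) _ (h.step_lt hA.pos.1 hA.totallyRetractive s t)
    (h.step_mem s t)
  rw [point_succ]
  exact norm_sq_add_le_of_descent hη h1

theorem StaysIn.sum_descent (hA : Assumptions R T ρ X xstar D F G σ L Ll θ μ ν) (hη : 0 < A.η)
    (hS : 0 < A.S) (hm : 0 < A.m) (h : StaysIn T ρ F A smp X) :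
    ∑ s, ∑ t, (‖grad E (objective D F) (iterate T ρ F A smp s t)‖ ^ 2
        + (1 - L * A.η) * ‖direction T ρ F A smp s t‖ ^ 2)
      ≤ 2 / A.η * (objective D F A.start - objective D F xstar)
        + ∑ s, ∑ t, ‖direction T ρ F A smp s t
            - grad E (objective D F) (iterate T ρ F A smp s t)‖ ^ 2 := by
  set f := objective D F
  have hepoch : ∀ s : Fin A.S, ∑ t : Fin A.m, (f (point T ρ F A smp s t.castSucc)
      - f (point T ρ F A smp s t.succ)) = f (epochState T ρ F A smp s.castSucc).1
        - f (epochState T ρ F A smp s.succ).1 := fun s => by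
    rw [sum_castSucc_sub_succ fun t => f (point T ρ F A smp s t), epochState_succ]
    rfl
  have htel : ∑ s : Fin A.S, ∑ t : Fin A.m, (f (point T ρ F A smp s t.castSucc)
      - f (point T ρ F A smp s t.succ)) = f A.start - f (epochState T ρ F A smp (Fin.last A.S)).1 := by
    rw [Finset.sum_congr rfl fun s _ => hepoch s,
      sum_castSucc_sub_succ fun s => f (epochState T ρ F A smp s).1]
    rfl
  -- The final point is no `iterate`; it lies in `X` as the endpoint of the last step of the last
  -- epoch, which exists because `S, m ≥ 1`.
  have hlast : f xstar ≤ f (epochState T ρ F A smp (Fin.last A.S)).1 := by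
    obtain ⟨S', hS'⟩ := Nat.exists_eq_succ_of_ne_zero hS.ne'
    obtain ⟨m', hm'⟩ := Nat.exists_eq_succ_of_ne_zero hm.ne'
    let s : Fin A.S := ⟨S', by omega⟩
    let t : Fin A.m := ⟨m', by omega⟩
    have hs : Fin.last A.S = s.succ := Fin.ext hS'
    have ht : Fin.last A.m = t.succ := Fin.ext hm'
    refine hA.isMinOn ?_
    rw [hs, epochState_succ, ht]
    change point T ρ F A smp s t.succ ∈ X
    rw [point_succ]
    exact h.step_mem s t
  calc _ ≤ ∑ s, ∑ t, (2 / A.η * (f (point T ρ F A smp s t.castSucc)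
          - f (point T ρ F A smp s t.succ)) + ‖direction T ρ F A smp s t
            - grad E f (iterate T ρ F A smp s t)‖ ^ 2) :=
        Finset.sum_le_sum fun s _ => Finset.sum_le_sum fun t _ => h.descent hA hη s t
    _ = 2 / A.η * (f A.start - f (epochState T ρ F A smp (Fin.last A.S)).1)
        + ∑ s, ∑ t, ‖direction T ρ F A smp s t - grad E f (iterate T ρ F A smp s t)‖ ^ 2 := by
        simp only [Finset.sum_add_distrib, ← Finset.mul_sum, htel]
    _ ≤ _ := by gcongr

/-- Within an epoch the iterates stay close to the snapshot point. -/
theorem StaysIn.edist_le (hA : Assumptions R T ρ X xstar D F G σ L Ll θ μ ν) (hη : 0 < A.η)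
    (h : StaysIn T ρ F A smp X) (s : Fin A.S) (t : Fin A.m) :
    edist (snapshot T ρ F A smp s) (iterate T ρ F A smp s t)
      ≤ ENNReal.ofReal (ν * A.η * ∑ k, ‖direction T ρ F A smp s k‖) := by
  have hν : 0 < ν := hA.pos.2.2.2.2.2.2.2
  have hstep : ∀ k : Fin A.m, edist (point T ρ F A smp s k.castSucc) (point T ρ F A smp s k.succ)
      ≤ ENNReal.ofReal (ν * A.η * ‖direction T ρ F A smp s k‖) := fun k => by
    have := (hA.distance _ (h.iterate_mem s k) _ (h.step_lt hA.pos.1 hA.totallyRetractive s k)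
      (h.step_mem s k)).2
    rwa [← point_succ, norm_neg, norm_smul, Real.norm_of_nonneg hη.le, ← mul_assoc] at this
  have hpart : ∀ t : Fin (A.m + 1), edist (point T ρ F A smp s 0) (point T ρ F A smp s t)
      ≤ ∑ k : Fin A.m with k.castSucc < t,
        ENNReal.ofReal (ν * A.η * ‖direction T ρ F A smp s k‖) := by
    intro t
    induction t using Fin.induction with
    | zero => simp
    | succ t ih =>
      refine (edist_triangle _ _ _).trans ((add_le_add ih (hstep t)).trans ?_)
      have hset : (Finset.univ.filter fun k : Fin A.m => k.castSucc < t.succ)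
          = insert t (Finset.univ.filter fun k : Fin A.m => k.castSucc < t.castSucc) := by
        ext k
        simp only [Finset.mem_filter, Finset.mem_univ, true_and, Finset.mem_insert, Fin.lt_def,
          Fin.ext_iff, Fin.val_castSucc, Fin.val_succ]
        omega
      rw [hset, Finset.sum_insert (by simp), add_comm]
  -- Extending the sum to the whole epoch makes the bound independent of `t`.
  refine (hpart t.castSucc).trans ((Finset.sum_le_sum_of_subset (Finset.filter_subset _ _)).trans ?_)
  rw [Finset.mul_sum, ENNReal.ofReal_sum_of_nonneg fun k _ => by positivity]

end Descent

/-- Resampling is done with `∫⁻`, the bookkeeping with real integrals. -/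
theorem integral_le_integral_of_lintegral_le {Ω : Type*} [MeasurableSpace Ω] {P : Measure Ω}
    {f g : Ω → ℝ} (hf : Integrable f P) (hg : Integrable g P) (hf0 : ∀ x, 0 ≤ f x)
    (hg0 : ∀ x, 0 ≤ g x)
    (h : ∫⁻ x, ENNReal.ofReal (f x) ∂P ≤ ∫⁻ x, ENNReal.ofReal (g x) ∂P) :
    ∫ x, f x ∂P ≤ ∫ x, g x ∂P := by
  rw [← ofReal_integral_eq_lintegral_ofReal hf (ae_of_all _ hf0),
    ← ofReal_integral_eq_lintegral_ofReal hg (ae_of_all _ hg0)] at h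
  exact (ENNReal.ofReal_le_ofReal_iff (integral_nonneg hg0)).1 h

/-! ### Error of the modified gradient -/

section MiniBatch

variable {E : Type*} [NormedAddCommGroup E] [NormedSpace ℝ E] [FiniteDimensional ℝ E]
  {M : Type*} [EMetricSpace M] [ChartedSpace E M] [IsManifold 𝓘(ℝ, E) ∞ M]
  [RiemannianBundle (fun x : M => TangentSpace 𝓘(ℝ, E) x)]
  [IsContMDiffRiemannianBundle 𝓘(ℝ, E) ∞ E (fun x : M => TangentSpace 𝓘(ℝ, E) x)]
  {Z : Type*} [MeasurableSpace Z] {D : Measure Z} [IsProbabilityMeasure D]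
  {R : Retraction E M} {T : VectorTransport R} {ρ : ℝ} {X : Set M} {xstar : M}
  {F : Z → M → ℝ} {G σ L Ll θ μ ν : ℝ}

theorem modifiedGrad_self (hρ : 0 < ρ) (hX : IsTotallyRetractive R ρ X xstar) {b : ℕ} {x : M}
    (hx : x ∈ X) (v : TangentSpace 𝓘(ℝ, E) x) (J : Fin b → Z) :
    modifiedGrad T ρ F x v J x = v := by
  rw [modifiedGrad, T.between_self hρ hX hx, sub_sub_cancel]

/-- Bias-variance decomposition: the mini-batch average of `Y` has the right mean, the transported
snapshot error does not depend on the mini-batch, and the variance of `Y` is at most its second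
moment, which the transport estimate bounds. -/
theorem lintegral_modifiedGrad_le (hA : Assumptions R T ρ X xstar D F G σ L Ll θ μ ν)
    (hU : UnbiasedOracle E X D F) {b : ℕ} (hb : 0 < b) {x₀ x : M} (hx₀ : x₀ ∈ X) (hx : x ∈ X)
    (v₀ : TangentSpace 𝓘(ℝ, E) x₀) {d : ℝ} (hd0 : 0 ≤ d) (hd : edist x₀ x ≤ ENNReal.ofReal d) :
    ∫⁻ J : Fin b → Z, ENNReal.ofReal
        (‖modifiedGrad T ρ F x₀ v₀ J x - grad E (objective D F) x‖ ^ 2) ∂(Measure.pi fun _ => D)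
      ≤ ENNReal.ofReal ((b : ℝ)⁻¹ * ((Ll + θ * G) * (μ * d)) ^ 2
        + ‖v₀ - grad E (objective D F) x₀‖ ^ 2) := by
  obtain ⟨U, r, hr0, hbet, hr, hint⟩ := hA.exists_transport hU hx₀ hx
  have hpos := hA.pos
  have hμ : 0 < μ := hpos.2.2.2.2.2.2.1
  have hrd : r ≤ μ * d := by
    rw [← ENNReal.ofReal_le_ofReal_iff (by positivity), ENNReal.ofReal_mul hμ.le]
    exact hr.trans (mul_le_mul_right hd _)
  have hfd : FiniteDimensional ℝ (TangentSpace 𝓘(ℝ, E) x) := ‹FiniteDimensional ℝ E›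
  have hfd₀ : FiniteDimensional ℝ (TangentSpace 𝓘(ℝ, E) x₀) := ‹FiniteDimensional ℝ E›
  have hcs : CompleteSpace (TangentSpace 𝓘(ℝ, E) x) := FiniteDimensional.complete ℝ _
  have hcs₀ : CompleteSpace (TangentSpace 𝓘(ℝ, E) x₀) := FiniteDimensional.complete ℝ _
  let Y : Z → TangentSpace 𝓘(ℝ, E) x := fun z => grad E (F z) x - U (grad E (F z) x₀)
  have hm : ∀ {y : M}, y ∈ X → MemLp (fun z => grad E (F z) y) 2 D := fun hy =>
    MemLp.of_bound (hU.measurable _ hy) G (ae_of_all _ fun z => hA.grad_bound z _ hy)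
  have hUm : MemLp (fun z => U (grad E (F z) x₀)) 2 D :=
    MemLp.of_bound (U.continuous.comp_aestronglyMeasurable (hU.measurable _ hx₀)) G
      (ae_of_all _ fun z => by rw [U.norm_map]; exact hA.grad_bound z _ hx₀)
  have hY : MemLp Y 2 D := (hm hx).sub hUm
  have hmean : ∫ z, Y z ∂D = grad E (objective D F) x - U (grad E (objective D F) x₀) := by
    rw [integral_sub ((hm hx).integrable (by norm_num)) (hUm.integrable (by norm_num)),
      hU.unbiased x hx]
    congr 1
    rw [← hU.unbiased x₀ hx₀]
    exact U.toContinuousLinearMap.integral_comp_comm ((hm hx₀).integrable (by norm_num))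
  have hdecomp : ∀ J : Fin b → Z,
      modifiedGrad T ρ F x₀ v₀ J x - grad E (objective D F) x
        = (b : ℝ)⁻¹ • ∑ j : Fin b with j.val < b, Y (J j) - ∫ z, Y z ∂D
          + U (v₀ - grad E (objective D F) x₀) := fun J => by
    rw [modifiedGrad, hbet, hmean]
    simp only [batchGrad, Y, Finset.sum_sub_distrib, smul_sub, map_sub, map_smul, map_sum]
    abel
  simp only [hdecomp]
  rw [lintegral_norm_average_sq hb le_rfl hY, U.norm_map]
  refine ENNReal.ofReal_le_ofReal (add_le_add_left (mul_le_mul_of_nonneg_left ?_ (by positivity)) _)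
  refine (integral_norm_sub_integral_sq_le hY).trans (hint.trans ?_)
  have : 0 ≤ Ll + θ * G := by
    have := mul_pos hpos.2.2.2.2.2.1 hpos.2.1
    linarith [hpos.2.2.2.2.1]
  gcongr

end MiniBatch

/-! ### Expected errors over a run -/

section Expectation

variable {E : Type*} [NormedAddCommGroup E] [NormedSpace ℝ E] [FiniteDimensional ℝ E]
  {M : Type*} [EMetricSpace M] [ChartedSpace E M] [IsManifold 𝓘(ℝ, E) ∞ M]
  [RiemannianBundle (fun x : M => TangentSpace 𝓘(ℝ, E) x)]
  [IsContMDiffRiemannianBundle 𝓘(ℝ, E) ∞ E (fun x : M => TangentSpace 𝓘(ℝ, E) x)]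
  {Z : Type*} [MeasurableSpace Z] {D : Measure Z} [IsProbabilityMeasure D]
  {R : Retraction E M} {T : VectorTransport R} {ρ : ℝ} {X : Set M} {xstar : M}
  {F : Z → M → ℝ} {G σ L Ll θ μ ν : ℝ} {A : Input M} {N : ℕ}

/-- A crude bound, used only for integrability. -/
theorem norm_direction_le (hA : Assumptions R T ρ X xstar D F G σ L Ll θ μ ν)
    (hU : UnbiasedOracle E X D F) (hm : 0 < A.m) {smp : Samples A.S A.m A.b N Z}
    (h : StaysIn T ρ F A smp X) (s : Fin A.S) (t : Fin A.m) :
    ‖direction T ρ F A smp s t‖ ≤ 3 * G := by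
  have hG := hA.pos.2.1.le
  have hx₀ := h.snapshot_mem hm s
  have hx := h.iterate_mem s t
  obtain ⟨U, -, -, hbet, -⟩ := hA.exists_transport hU hx₀ hx
  rw [direction, modifiedGrad, hbet]
  refine (norm_sub_le _ _).trans ?_
  rw [U.norm_map]
  have h1 := norm_batchGrad_le hA.grad_bound A.b ((smp s).2 t) hx hG
  have h2 := norm_batchGrad_le hA.grad_bound A.b ((smp s).2 t) hx₀ hG
  have h3 : ‖snapshotGrad T ρ F A smp s‖ ≤ G := norm_batchGrad_le hA.grad_bound _ _ hx₀ hG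
  have h4 := norm_sub_le (batchGrad (E := E) F A.b ((smp s).2 t) (snapshot T ρ F A smp s))
    (snapshotGrad T ρ F A smp s)
  linarith

theorem norm_direction_sub_eq (hA : Assumptions R T ρ X xstar D F G σ L Ll θ μ ν)
    (hm : 0 < A.m) {smp : Samples A.S A.m A.b N Z}
    (h : StaysIn T ρ F A smp X) (s : Fin A.S) (f : M → ℝ) :
    ‖direction T ρ F A smp s ⟨0, hm⟩ - grad E f (iterate T ρ F A smp s ⟨0, hm⟩)‖ ^ 2
      = ‖snapshotGrad T ρ F A smp s - grad E f (snapshot T ρ F A smp s)‖ ^ 2 := by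
  have h0 := iterate_eq_snapshot T ρ F A smp s ⟨0, hm⟩ rfl
  have h1 := congrArg (fun x => ‖modifiedGrad T ρ F (snapshot T ρ F A smp s)
      (snapshotGrad T ρ F A smp s) ((smp s).2 ⟨0, hm⟩) x - grad E f x‖ ^ 2) h0
  refine h1.trans ?_
  simp only [modifiedGrad_self hA.pos.1 hA.totallyRetractive (h.snapshot_mem hm s)]

/-- Redraw mini-batch `t` and integrate it out. The first direction of the epoch equals the snapshot
gradient, so its error stands for the snapshot error. -/
theorem lintegral_error_le (hA : Assumptions R T ρ X xstar D F G σ L Ll θ μ ν)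
    (hU : UnbiasedOracle E X D F) (hm : 0 < A.m) (hb : 0 < A.b) (hη : 0 < A.η)
    {Q : Measure (Fin N → Z)} [IsProbabilityMeasure Q]
    (hrun : IsMeasurableRun T ρ F A N)
    (hstay : ∀ᵐ smp ∂(sampleLaw A.S A.m A.b N Q D), StaysIn T ρ F A smp X)
    (s : Fin A.S) (t : Fin A.m) :
    ∫⁻ smp, ENNReal.ofReal (‖direction T ρ F A smp s t
        - grad E (objective D F) (iterate T ρ F A smp s t)‖ ^ 2) ∂(sampleLaw A.S A.m A.b N Q D)
      ≤ ∫⁻ smp, ENNReal.ofReal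
        ((A.b : ℝ)⁻¹ * (Ll + θ * G) ^ 2 * (μ * ν * A.η) ^ 2 * A.m
            * ∑ k, ‖direction T ρ F A smp s k‖ ^ 2
          + ‖direction T ρ F A smp s ⟨0, hm⟩
              - grad E (objective D F) (iterate T ρ F A smp s ⟨0, hm⟩)‖ ^ 2)
        ∂(sampleLaw A.S A.m A.b N Q D) := by
  have hmeas := ((measurable_norm_sub_grad_sq hA.contMDiff_objective).comp (hrun s t))
  refine lintegral_le_of_resample (measurePreserving_resampleMiniBatch s t)
    hmeas.ennreal_ofReal ?_
  filter_upwards [hstay] with smp h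
  simp only [errorSq_resampleMiniBatch]
  have hν : 0 < ν := hA.pos.2.2.2.2.2.2.2
  refine (lintegral_modifiedGrad_le hA hU hb (h.snapshot_mem hm s) (h.iterate_mem s t)
    (snapshotGrad T ρ F A smp s) (by positivity) (h.edist_le hA hη s t)).trans ?_
  rw [norm_direction_sub_eq hA hm h]
  refine ENNReal.ofReal_le_ofReal (add_le_add_left ?_ _)
  -- Cauchy-Schwarz over the epoch; summing over `t` later gives the second factor `m` in the step
  -- size rule.
  have hcs := sq_sum_le_card_mul_sum_sq (s := Finset.univ)
    (f := fun k : Fin A.m => ‖direction T ρ F A smp s k‖)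
  rw [Finset.card_univ, Fintype.card_fin] at hcs
  calc (A.b : ℝ)⁻¹ * ((Ll + θ * G) * (μ * (ν * A.η * ∑ k, ‖direction T ρ F A smp s k‖))) ^ 2
      = (A.b : ℝ)⁻¹ * (Ll + θ * G) ^ 2 * (μ * ν * A.η) ^ 2
          * (∑ k, ‖direction T ρ F A smp s k‖) ^ 2 := by ring
    _ ≤ (A.b : ℝ)⁻¹ * (Ll + θ * G) ^ 2 * (μ * ν * A.η) ^ 2
          * (A.m * ∑ k, ‖direction T ρ F A smp s k‖ ^ 2) := by gcongr
    _ = _ := by ring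

theorem epochState_snd_nonneg (hβ₁ : 0 ≤ A.β₁) (smp : Samples A.S A.m A.b N Z)
    (s : Fin (A.S + 1)) : 0 ≤ (epochState T ρ F A smp s).2 := by
  cases s using Fin.cases with
  | zero => exact hβ₁
  | succ s =>
    rw [epochState_succ]
    dsimp only
    positivity

/-- Redraw the batch: its size and the snapshot point are fixed by earlier epochs, so `hbatch`
applies for each fixed past. -/
theorem lintegral_snapshot_error_le (hA : Assumptions R T ρ X xstar D F G σ L Ll θ μ ν)
    (hm : 0 < A.m) (hβ₁ : 0 ≤ A.β₁)
    {Q : Measure (Fin N → Z)} [IsProbabilityMeasure Q] (hrun : IsMeasurableRun T ρ F A N)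
    (hstay : ∀ᵐ smp ∂(sampleLaw A.S A.m A.b N Q D), StaysIn T ρ F A smp X) {ε α : ℝ}
    (hbatch : ∀ β, 0 ≤ β → ∀ x ∈ X, ∫⁻ ζ, ENNReal.ofReal
      (‖batchGrad F (A.batchSize β) ζ x - grad E (objective D F) x‖ ^ 2) ∂Q
        ≤ ENNReal.ofReal ((β + ε ^ 2) / α))
    (s : Fin A.S) :
    ∫⁻ smp, ENNReal.ofReal (‖direction T ρ F A smp s ⟨0, hm⟩
        - grad E (objective D F) (iterate T ρ F A smp s ⟨0, hm⟩)‖ ^ 2)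
          ∂(sampleLaw A.S A.m A.b N Q D)
      ≤ ∫⁻ smp, ENNReal.ofReal (((epochState T ρ F A smp s.castSucc).2 + ε ^ 2) / α)
        ∂(sampleLaw A.S A.m A.b N Q D) := by
  have hmeas := ((measurable_norm_sub_grad_sq hA.contMDiff_objective).comp (hrun s ⟨0, hm⟩))
  refine lintegral_le_of_resample (measurePreserving_resampleBatch s) hmeas.ennreal_ofReal ?_
  filter_upwards [hstay] with smp h
  simp only [errorSq_resampleBatch]
  simp only [modifiedGrad_self hA.pos.1 hA.totallyRetractive (h.snapshot_mem hm s)]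
  exact hbatch _ (epochState_snd_nonneg hβ₁ smp _) _ (h.snapshot_mem hm s)

end Expectation

/-- Here `g`, `e`, `V`, `β` are expectations. The errors cost `c * m + 1 / α` times the sum of `V`,
against the `1 - L * η` available from descent. -/
theorem bound_of_sums {S m : ℕ} (hS : 0 < S) (hm : 0 < m) {g e : Fin S → Fin m → ℝ}
    {V : Fin S → ℝ} {β : Fin (S + 1) → ℝ} {η L Δ c α ε : ℝ} (hη : 0 < η) (hα : 4 ≤ α)
    (hV : ∀ s, 0 ≤ V s) (t₀ : Fin m)
    (hdescent : ∑ s, ∑ t, g s t + (1 - L * η) * ∑ s, V s ≤ 2 / η * Δ + ∑ s, ∑ t, e s t)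
    (herr : ∀ s t, e s t ≤ c * V s + e s t₀)
    (hsnap : ∀ s, e s t₀ ≤ (β s.castSucc + ε ^ 2) / α)
    (hβ0 : β 0 ≤ ε ^ 2 * S) (hβnn : ∀ s, 0 ≤ β s) (hβ : ∀ s : Fin S, β s.succ = V s / m)
    (hstep : c * m + L * η ≤ 1 - 1 / α) :
    (S * m : ℝ)⁻¹ * ∑ s, ∑ t, g s t ≤ 2 * Δ / (S * m * η) + ε ^ 2 / 2 := by
  have hα0 : 0 < α := by linarith
  have hS' : (0 : ℝ) < S := by exact_mod_cast hS
  have hm' : (0 : ℝ) < m := by exact_mod_cast hm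
  -- Shift of index: `β 0` is the input, each later `β` is the mean of the epoch before it, and the
  -- unused last one is dropped as nonnegative.
  have hsumβ : ∑ s : Fin S, β s.castSucc ≤ ε ^ 2 * S + (∑ s, V s) / m := by
    have h1 := Fin.sum_univ_succ β
    have h2 := Fin.sum_univ_castSucc β
    have h3 := hβnn (Fin.last S)
    simp only [hβ, ← Finset.sum_div] at h1
    linarith
  have hsume : ∑ s, ∑ t, e s t ≤ ∑ s, (m * (c * V s) + m * ((β s.castSucc + ε ^ 2) / α)) := by
    refine Finset.sum_le_sum fun s _ => ?_
    calc ∑ t, e s t ≤ ∑ _t : Fin m, (c * V s + (β s.castSucc + ε ^ 2) / α) :=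
          Finset.sum_le_sum fun t _ => (herr s t).trans (by linarith [hsnap s])
      _ = _ := by
          rw [Finset.sum_const, Finset.card_univ, Fintype.card_fin, nsmul_eq_mul]
          ring
  have hsum2 : ∑ s : Fin S, (m * (c * V s) + m * ((β s.castSucc + ε ^ 2) / α))
      = c * m * ∑ s, V s + m / α * (∑ s : Fin S, β s.castSucc + S * ε ^ 2) := by
    rw [Finset.sum_add_distrib, ← Finset.mul_sum, ← Finset.mul_sum, ← Finset.mul_sum,
      ← Finset.sum_div, Finset.sum_add_distrib, Finset.sum_const, Finset.card_univ,
      Fintype.card_fin, nsmul_eq_mul]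
    ring
  have hbound : (m : ℝ) / α * (∑ s : Fin S, β s.castSucc + S * ε ^ 2)
      ≤ 1 / α * ∑ s, V s + m * S * ε ^ 2 / 2 := by
    have h1 : (m : ℝ) / α * (∑ s : Fin S, β s.castSucc + S * ε ^ 2)
        ≤ m / α * (ε ^ 2 * S + (∑ s, V s) / m + S * ε ^ 2) := by gcongr
    have h2 : (m : ℝ) / α * (ε ^ 2 * S + (∑ s, V s) / m + S * ε ^ 2)
        = 1 / α * ∑ s, V s + m * S * ε ^ 2 * (2 / α) := by
      field_simp
      ring
    -- The term `ε²` occurs twice, from the batches and from `β 0`; `α ≥ 4` reduces the total to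
    -- `ε²/2`.
    have h3 : 2 / α ≤ 1 / 2 := by
      rw [div_le_div_iff₀ hα0 two_pos]
      linarith
    have h4 : (m : ℝ) * S * ε ^ 2 * (2 / α) ≤ m * S * ε ^ 2 * (1 / 2) :=
      mul_le_mul_of_nonneg_left h3 (by positivity)
    linarith
  have hVs : 0 ≤ ∑ s, V s := Finset.sum_nonneg fun s _ => hV s
  have hfin : ∑ s, ∑ t, g s t ≤ 2 / η * Δ + m * S * ε ^ 2 / 2 := by
    nlinarith [mul_nonneg (sub_nonneg.2 hstep) hVs]
  calc (S * m : ℝ)⁻¹ * ∑ s, ∑ t, g s t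
      ≤ (S * m : ℝ)⁻¹ * (2 / η * Δ + m * S * ε ^ 2 / 2) := by gcongr
    _ = _ := by field_simp

/-- The bound on `η` is the positive root of `K η² + L η = a`, rationalised so that it also makes
sense for `K = 0`. -/
theorem step_condition {L K a η : ℝ} (hL : 0 < L) (hK : 0 ≤ K) (ha : 0 ≤ a) (hη : 0 < η)
    (h : η ≤ 2 * a / (L + √(L ^ 2 + 4 * a * K))) : K * η ^ 2 + L * η ≤ a := by
  set r := √(L ^ 2 + 4 * a * K) with hr
  have hr0 : 0 ≤ r := Real.sqrt_nonneg _
  have hr2 : r ^ 2 = L ^ 2 + 4 * a * K := Real.sq_sqrt (by positivity)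
  have h1 : η * (L + r) ≤ 2 * a := (le_div_iff₀ (by positivity)).1 h
  rcases hK.eq_or_lt with rfl | hK0
  · have : r = L := by
      rw [← sq_eq_sq₀ hr0 hL.le, hr2]
      ring
    rw [this] at h1
    linarith
  · have hrL : L ≤ r := by
      rw [← sq_le_sq₀ hL.le hr0, hr2]
      have := mul_nonneg ha hK
      linarith
    -- From `(r - L)(r + L) = 4aK`. Hence `K η² + L η ≤ η (r + L) / 2 ≤ a`.
    have h2 : 2 * K * η ≤ r - L := by
      have h3 : (r - L) * (r + L) = 2 * (2 * a) * K := by ring_nf; rw [hr2]; ring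
      have h4 : 2 * K * η * (r + L) ≤ (r - L) * (r + L) := by
        rw [h3]
        nlinarith [mul_le_mul_of_nonneg_left h1 hK]
      exact le_of_mul_le_mul_right h4 (by linarith)
    have h5 := mul_le_mul_of_nonneg_right h2 hη.le
    nlinarith

/-! ### The bound for a general batch law -/

section General

variable {E : Type*} [NormedAddCommGroup E] [NormedSpace ℝ E] [FiniteDimensional ℝ E]
  {M : Type*} [EMetricSpace M] [ChartedSpace E M] [IsManifold 𝓘(ℝ, E) ∞ M]
  [RiemannianBundle (fun x : M => TangentSpace 𝓘(ℝ, E) x)]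
  [IsContMDiffRiemannianBundle 𝓘(ℝ, E) ∞ E (fun x : M => TangentSpace 𝓘(ℝ, E) x)]
  {Z : Type*} [MeasurableSpace Z] {D : Measure Z} [IsProbabilityMeasure D]
  {R : Retraction E M} {T : VectorTransport R} {ρ : ℝ} {X : Set M} {xstar : M}
  {F : Z → M → ℝ} {G σ L Ll θ μ ν : ℝ} {A : Input M} {N : ℕ}

theorem measurable_norm_grad_iterate_sq {f : M → ℝ} (hf : ContMDiff 𝓘(ℝ, E) 𝓘(ℝ, ℝ) 2 f)
    (hrun : IsMeasurableRun T ρ F A N) (s : Fin A.S) (t : Fin A.m) :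
    Measurable fun smp : Samples A.S A.m A.b N Z =>
      ‖grad E f (iterate T ρ F A smp s t)‖ ^ 2 := by
  have h := (measurable_norm_grad_sq hf).comp (hrun s t)
  exact h

theorem measurable_norm_direction_sub_grad_sq {f : M → ℝ} (hf : ContMDiff 𝓘(ℝ, E) 𝓘(ℝ, ℝ) 2 f)
    (hrun : IsMeasurableRun T ρ F A N) (s : Fin A.S) (t : Fin A.m) :
    Measurable fun smp : Samples A.S A.m A.b N Z =>
      ‖direction T ρ F A smp s t - grad E f (iterate T ρ F A smp s t)‖ ^ 2 := by
  have h := (measurable_norm_sub_grad_sq hf).comp (hrun s t)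
  exact h

theorem measurable_norm_direction_sq (hrun : IsMeasurableRun T ρ F A N) (s : Fin A.S)
    (t : Fin A.m) :
    Measurable fun smp : Samples A.S A.m A.b N Z => ‖direction T ρ F A smp s t‖ ^ 2 := by
  have h := measurable_norm_sq.comp (hrun s t)
  exact h

/-- The output bound, for a law `Q` of the batch whose mean square error is at most
`(β + ε²) / α`. -/
theorem outputBound_of_batch (hA : Assumptions R T ρ X xstar D F G σ L Ll θ μ ν)
    (hU : UnbiasedOracle E X D F) (hS : 0 < A.S) (hm : 0 < A.m) (hb : 0 < A.b) (hη : 0 < A.η)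
    {ε α : ℝ} (hα : 4 ≤ α) (hβ₁ : 0 ≤ A.β₁) (hβ₁' : A.β₁ ≤ ε ^ 2 * A.S)
    {Q : Measure (Fin N → Z)} [IsProbabilityMeasure Q] (hrun : IsMeasurableRun T ρ F A N)
    (hstay : ∀ᵐ smp ∂(sampleLaw A.S A.m A.b N Q D), StaysIn T ρ F A smp X)
    (hbatch : ∀ β, 0 ≤ β → ∀ x ∈ X, ∫⁻ ζ, ENNReal.ofReal
      (‖batchGrad F (A.batchSize β) ζ x - grad E (objective D F) x‖ ^ 2) ∂Q
        ≤ ENNReal.ofReal ((β + ε ^ 2) / α))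
    (hη' : A.η ≤ (2 - 2 / α) /
      (L + √(L ^ 2 + 4 * (1 - 1 / α) * ((Ll + θ * G) ^ 2 * μ ^ 2 * ν ^ 2 * A.m ^ 2 / A.b)))) :
    OutputBound T ρ F A (objective D F) (sampleLaw A.S A.m A.b N Q D)
      (2 * (objective D F A.start - objective D F xstar) / ((A.S * A.m : ℕ) * A.η)
        + ε ^ 2 / 2) := by
  have hG := hA.pos.2.1
  have hα0 : 0 < α := by linarith
  have hprob : IsProbabilityMeasure (sampleLaw A.S A.m A.b N Q D) := by
    unfold sampleLaw
    infer_instance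
  set P := sampleLaw A.S A.m A.b N Q D with hP
  set f := objective D F with hf
  let g : Fin A.S → Fin A.m → Samples A.S A.m A.b N Z → ℝ := fun s t smp =>
    ‖grad E f (iterate T ρ F A smp s t)‖ ^ 2
  let e : Fin A.S → Fin A.m → Samples A.S A.m A.b N Z → ℝ := fun s t smp =>
    ‖direction T ρ F A smp s t - grad E f (iterate T ρ F A smp s t)‖ ^ 2
  let w : Fin A.S → Fin A.m → Samples A.S A.m A.b N Z → ℝ := fun s t smp =>
    ‖direction T ρ F A smp s t‖ ^ 2
  have hgm : ∀ s t, Measurable (g s t) := fun s t =>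
    measurable_norm_grad_iterate_sq hA.contMDiff_objective hrun s t
  have hem : ∀ s t, Measurable (e s t) := fun s t =>
    measurable_norm_direction_sub_grad_sq hA.contMDiff_objective hrun s t
  have hwm : ∀ s t, Measurable (w s t) := fun s t => measurable_norm_direction_sq hrun s t
  have hgb : ∀ s t, ∀ᵐ smp ∂P, ‖g s t smp‖ ≤ G ^ 2 := fun s t => by
    filter_upwards [hstay] with smp h
    rw [Real.norm_of_nonneg (sq_nonneg _)]
    exact pow_le_pow_left₀ (norm_nonneg _) (hA.norm_grad_objective_le hU (h.iterate_mem s t)) 2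
  have hgi : ∀ s t, Integrable (g s t) P := fun s t =>
    Integrable.of_bound (hgm s t).aestronglyMeasurable _ (hgb s t)
  have hwi : ∀ s t, Integrable (w s t) P := fun s t => by
    refine Integrable.of_bound (hwm s t).aestronglyMeasurable ((3 * G) ^ 2) ?_
    filter_upwards [hstay] with smp h
    rw [Real.norm_of_nonneg (sq_nonneg _)]
    exact pow_le_pow_left₀ (norm_nonneg _) (norm_direction_le hA hU hm h s t) 2
  have hei : ∀ s t, Integrable (e s t) P := fun s t => by
    refine Integrable.of_bound (hem s t).aestronglyMeasurable ((3 * G + G) ^ 2) ?_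
    filter_upwards [hstay] with smp h
    rw [Real.norm_of_nonneg (sq_nonneg _)]
    exact pow_le_pow_left₀ (norm_nonneg _) ((norm_sub_le _ _).trans (add_le_add
      (norm_direction_le hA hU hm h s t)
      (hA.norm_grad_objective_le hU (h.iterate_mem s t)))) 2
  have hVi : ∀ s, Integrable (fun smp => ∑ t, w s t smp) P := fun s =>
    integrable_finsetSum _ fun t _ => hwi s t
  have hβsucc : ∀ (s : Fin A.S) smp, (epochState T ρ F A smp s.succ).2 = (∑ t, w s t smp) / A.m :=
    fun s smp => by
      rw [epochState_succ, Finset.sum_div]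
  have hβi : ∀ s, Integrable (fun smp : Samples A.S A.m A.b N Z =>
      (epochState T ρ F A smp s).2) P := by
    intro s
    cases s using Fin.cases with
    | zero => exact integrable_const A.β₁
    | succ s =>
      simp only [hβsucc]
      exact (hVi s).div_const _
  let t₀ : Fin A.m := ⟨0, hm⟩
  -- The noise factor of `lintegral_error_le`; `c * m` is `K η²` in the step condition.
  let c : ℝ := (A.b : ℝ)⁻¹ * (Ll + θ * G) ^ 2 * (μ * ν * A.η) ^ 2 * A.m
  have hc : 0 ≤ c := by positivity
  have hdescent : ∑ s, ∑ t, ∫ smp, g s t smp ∂P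
      + (1 - L * A.η) * ∑ s, ∫ smp, (∑ t, w s t smp) ∂P
      ≤ 2 / A.η * (f A.start - f xstar) + ∑ s, ∑ t, ∫ smp, e s t smp ∂P := by
    have hsg : Integrable (fun smp => ∑ s, ∑ t, g s t smp) P :=
      integrable_finsetSum _ fun s _ => integrable_finsetSum _ fun t _ => hgi s t
    have hsV : Integrable (fun smp => ∑ s, ∑ t, w s t smp) P :=
      integrable_finsetSum _ fun s _ => hVi s
    have hse : Integrable (fun smp => ∑ s, ∑ t, e s t smp) P :=
      integrable_finsetSum _ fun s _ => integrable_finsetSum _ fun t _ => hei s t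
    have hle : ∫ smp, (∑ s, ∑ t, g s t smp + (1 - L * A.η) * ∑ s, ∑ t, w s t smp) ∂P
        ≤ ∫ smp, (2 / A.η * (f A.start - f xstar) + ∑ s, ∑ t, e s t smp) ∂P := by
      refine integral_mono_ae (hsg.add (hsV.const_mul _)) ((integrable_const _).add hse) ?_
      filter_upwards [hstay] with smp h
      have := h.sum_descent hA hη hS hm
      simp only [Finset.sum_add_distrib, ← Finset.mul_sum] at this
      exact this
    rw [integral_add hsg (hsV.const_mul _), integral_add (integrable_const _) hse,
      integral_const_mul, integral_finsetSum _ fun s _ => integrable_finsetSum _ fun t _ => hgi s t,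
      integral_finsetSum _ fun s _ => hVi s,
      integral_finsetSum _ fun s _ => integrable_finsetSum _ fun t _ => hei s t] at hle
    simpa only [integral_finsetSum _ fun t _ => hgi _ t, integral_finsetSum _ fun t _ => hei _ t,
      integral_const, probReal_univ, one_smul] using hle
  have herr : ∀ s t, ∫ smp, e s t smp ∂P
      ≤ c * ∫ smp, (∑ t, w s t smp) ∂P + ∫ smp, e s t₀ smp ∂P := fun s t => by
    rw [← integral_const_mul, ← integral_add ((hVi s).const_mul c) (hei s t₀)]
    exact integral_le_integral_of_lintegral_le (hei s t) (((hVi s).const_mul c).add (hei s t₀))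
      (fun _ => sq_nonneg _) (fun _ => by positivity)
      (lintegral_error_le hA hU hm hb hη hrun hstay s t)
  have hsnap : ∀ s : Fin A.S, ∫ smp, e s t₀ smp ∂P
      ≤ (∫ smp, (epochState T ρ F A smp s.castSucc).2 ∂P + ε ^ 2) / α := fun s => by
    have h1 : ∫ smp, ((epochState T ρ F A smp s.castSucc).2 + ε ^ 2) / α ∂P
        = (∫ smp, (epochState T ρ F A smp s.castSucc).2 ∂P + ε ^ 2) / α := by
      rw [integral_div, integral_add (hβi _) (integrable_const _)]
      simp
    rw [← h1]
    refine integral_le_integral_of_lintegral_le (hei s t₀)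
      (((hβi s.castSucc).add (integrable_const (ε ^ 2))).div_const α) (fun _ => sq_nonneg _)
      (fun smp => ?_) (lintegral_snapshot_error_le hA hm hβ₁ hrun hstay hbatch s)
    have := epochState_snd_nonneg (T := T) (ρ := ρ) (F := F) hβ₁ smp s.castSucc
    positivity
  have hstep : c * A.m + L * A.η ≤ 1 - 1 / α := by
    have h1 : 1 / α ≤ 1 := by
      rw [div_le_one hα0]
      linarith
    have h2 := step_condition (K := (Ll + θ * G) ^ 2 * μ ^ 2 * ν ^ 2 * A.m ^ 2 / A.b)
      (a := 1 - 1 / α) hA.pos.2.2.2.1 (by positivity) (by linarith) hη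
      (hη'.trans_eq (by congr 1; ring))
    refine le_trans (le_of_eq ?_) h2
    simp only [c]
    field_simp
  have hmain := bound_of_sums hS hm (g := fun s t => ∫ smp, g s t smp ∂P)
    (e := fun s t => ∫ smp, e s t smp ∂P) (V := fun s => ∫ smp, (∑ t, w s t smp) ∂P)
    (β := fun s => ∫ smp, (epochState T ρ F A smp s).2 ∂P) hη hα
    (fun s => integral_nonneg fun smp => Finset.sum_nonneg fun t _ => sq_nonneg _) t₀
    hdescent herr hsnap
    (by
      have : ∀ smp : Samples A.S A.m A.b N Z, (epochState T ρ F A smp 0).2 = A.β₁ := fun _ => rfl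
      simpa [this] using hβ₁')
    (fun s => integral_nonneg fun smp => epochState_snd_nonneg hβ₁ smp s)
    (fun s => by simp only [hβsucc, integral_div]) hstep
  have : NeZero A.S := ⟨hS.ne'⟩
  have : NeZero A.m := ⟨hm.ne'⟩
  have hunif : IsProbabilityMeasure
      (ProbabilityTheory.uniformOn (Set.univ : Set (Fin A.S × Fin A.m))) :=
    ProbabilityTheory.isProbabilityMeasure_uniformOn Set.finite_univ Set.univ_nonempty
  have hint : Integrable (fun p : Samples A.S A.m A.b N Z × (Fin A.S × Fin A.m) =>
      g p.2.1 p.2.2 p.1) (P.prod (ProbabilityTheory.uniformOn Set.univ)) := by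
    have hmeas : Measurable (fun p : Samples A.S A.m A.b N Z × (Fin A.S × Fin A.m) =>
        g p.2.1 p.2.2 p.1) :=
      measurable_from_prod_countable_left fun q => hgm q.1 q.2
    refine Integrable.of_bound hmeas.aestronglyMeasurable (G ^ 2) ?_
    have hall : ∀ᵐ smp ∂P, ∀ s t, ‖g s t smp‖ ≤ G ^ 2 :=
      ae_all_iff.2 fun s => ae_all_iff.2 fun t => hgb s t
    filter_upwards [(measurePreserving_fst (μ := P) (ν := ProbabilityTheory.uniformOn
      (Set.univ : Set (Fin A.S × Fin A.m)))).quasiMeasurePreserving.ae hall] with p hp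
    exact hp _ _
  refine ⟨hint, ?_⟩
  -- Fubini: the uniform random index averages over the `S * m` iterates.
  have hval : ∫ p : Samples A.S A.m A.b N Z × (Fin A.S × Fin A.m), g p.2.1 p.2.2 p.1
      ∂(P.prod (ProbabilityTheory.uniformOn Set.univ))
      = (A.S * A.m : ℝ)⁻¹ * ∑ s, ∑ t, ∫ smp, g s t smp ∂P := by
    rw [integral_prod_symm _ hint, integral_fintype Integrable.of_finite]
    have hreal : ∀ q : Fin A.S × Fin A.m, (ProbabilityTheory.uniformOn
        (Set.univ : Set (Fin A.S × Fin A.m))).real {q} = (A.S * A.m : ℝ)⁻¹ := fun q => by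
      simp [measureReal_def, ProbabilityTheory.uniformOn_univ]
    simp only [hreal, smul_eq_mul, ← Finset.mul_sum, Fintype.sum_prod_type]
  refine hval.trans_le (hmain.trans_eq ?_)
  push_cast
  rfl

end General

/-! ### Gradient of a finite average -/

section FiniteSum

variable {E : Type*} [NormedAddCommGroup E] [NormedSpace ℝ E] [FiniteDimensional ℝ E]
  {M : Type*} [EMetricSpace M] [ChartedSpace E M] [IsManifold 𝓘(ℝ, E) ∞ M]
  [RiemannianBundle (fun x : M => TangentSpace 𝓘(ℝ, E) x)]

theorem mvfderiv_finsetSum {ι : Type} (s : Finset ι) {F : ι → M → ℝ} {x : M}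
    (hF : ∀ i, MDifferentiableAt 𝓘(ℝ, E) 𝓘(ℝ, ℝ) (F i) x) :
    mvfderiv 𝓘(ℝ, E) (∑ i ∈ s, F i) x = ∑ i ∈ s, mvfderiv 𝓘(ℝ, E) (F i) x := by
  classical
  induction s using Finset.induction_on with
  | empty => simp only [Finset.sum_empty, mvfderiv_zero]
  | insert i s hi ih =>
    have hs : MDifferentiableAt 𝓘(ℝ, E) 𝓘(ℝ, ℝ) (∑ j ∈ s, F j) x :=
      MDifferentiableAt.sum fun j _ => hF j
    rw [Finset.sum_insert hi, Finset.sum_insert hi, mvfderiv_add (hF i) hs, ih]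

theorem grad_average {n : ℕ} {F : Fin n → M → ℝ} {x : M}
    (hF : ∀ i, MDifferentiableAt 𝓘(ℝ, E) 𝓘(ℝ, ℝ) (F i) x) :
    grad E (objective (ProbabilityTheory.uniformOn Set.univ) F) x
      = (1 / n : ℝ) • ∑ i, grad E (F i) x := by
  have hobj : objective (ProbabilityTheory.uniformOn Set.univ) F
      = (fun _ : M => (1 / n : ℝ)) * ∑ i, F i := by
    funext y
    rw [objective_uniformOn, Pi.mul_apply, Finset.sum_apply]
  refine ext_inner_right ℝ fun v => ?_
  rw [inner_grad, hobj, mvfderiv_mul mdifferentiableAt_const (MDifferentiableAt.sum fun j _ => hF j),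
    mvfderiv_const, mvfderiv_finsetSum _ hF, real_inner_smul_left, sum_inner]
  simp only [inner_grad]
  simp

theorem integral_uniformOn_univ {H : Type*} [NormedAddCommGroup H] [NormedSpace ℝ H]
    [CompleteSpace H] {n : ℕ} (Y : Fin n → H) :
    ∫ i, Y i ∂(ProbabilityTheory.uniformOn Set.univ) = (1 / n : ℝ) • ∑ i, Y i := by
  have h : ∀ i : Fin n, (ProbabilityTheory.uniformOn Set.univ : Measure (Fin n)).real {i}
      = 1 / n := fun i => by
    simp [measureReal_def, ProbabilityTheory.uniformOn_univ]
  rw [integral_fintype Integrable.of_finite, Finset.smul_sum]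
  simp only [h]

theorem unbiasedOracle_uniformOn {n : ℕ} {F : Fin n → M → ℝ} (hn : 0 < n)
    (hF : ∀ i, ContMDiff 𝓘(ℝ, E) 𝓘(ℝ, ℝ) 2 (F i)) (X : Set M) :
    UnbiasedOracle E X (ProbabilityTheory.uniformOn Set.univ) F := by
  have : NeZero n := ⟨hn.ne'⟩
  refine ⟨fun x => Integrable.of_finite, fun x _ => AEStronglyMeasurable.of_discrete,
    fun x _ => ?_⟩
  have hfd : FiniteDimensional ℝ (TangentSpace 𝓘(ℝ, E) x) := ‹FiniteDimensional ℝ E›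
  have hcs : CompleteSpace (TangentSpace 𝓘(ℝ, E) x) := FiniteDimensional.complete ℝ _
  rw [integral_uniformOn_univ,
    grad_average fun i => (hF i).contMDiffAt.mdifferentiableAt (by norm_num)]

end FiniteSum

/-! ### Batches drawn without replacement -/

section Ordering

variable {H : Type*} [NormedAddCommGroup H] [InnerProductSpace ℝ H]

/-- The mean square error of the average of a sample of size `B` without replacement. -/
theorem lintegral_orderingLaw_norm_average_sq_le {n B : ℕ} (hB : 0 < B) (hBn : B ≤ n)
    {Y : Fin n → H} {m : H} (hm : m = (1 / n : ℝ) • ∑ i, Y i) :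
    ∫⁻ ζ, ENNReal.ofReal (‖(B : ℝ)⁻¹ • ∑ j : Fin n with j.val < B, Y (ζ j) - m‖ ^ 2)
        ∂(orderingLaw n)
      ≤ ENNReal.ofReal ((B : ℝ)⁻¹ * ((1 / n : ℝ) * ∑ i, ‖Y i - m‖ ^ 2)) := by
  have hB' : (0 : ℝ) < B := by exact_mod_cast hB
  have hn' : (0 : ℝ) < n := by exact_mod_cast hB.trans_le hBn
  set J := Finset.univ.filter fun j : Fin n => j.val < B with hJ
  have hcard : J.card = B := by rw [hJ, Fin.card_filter_val_lt, min_eq_right hBn]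
  have hzero : ∑ i, (Y i - m) = 0 := by
    rw [Finset.sum_sub_distrib, Finset.sum_const, Finset.card_univ, Fintype.card_fin, hm,
      ← Nat.cast_smul_eq_nsmul ℝ, smul_smul, mul_one_div_cancel hn'.ne', one_smul, sub_self]
  -- Centring makes the population sum zero, as the permutation estimate requires.
  have hcenter : ∀ ζ : Fin n → Fin n, (B : ℝ)⁻¹ • ∑ j ∈ J, Y (ζ j) - m
      = (B : ℝ)⁻¹ • ∑ j ∈ J, (Y (ζ j) - m) := fun ζ => by
    rw [Finset.sum_sub_distrib, Finset.sum_const, hcard, smul_sub, ← Nat.cast_smul_eq_nsmul ℝ,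
      smul_smul, inv_mul_cancel₀ hB'.ne', one_smul]
  have hsum := sum_perm_norm_sum_sq_le hzero J
  rw [hcard] at hsum
  have hK : (0 : ℝ) < Fintype.card (Equiv.Perm (Fin n)) := by exact_mod_cast Fintype.card_pos
  simp only [hcenter, norm_smul, mul_pow]
  rw [lintegral_orderingLaw, ← ENNReal.ofReal_sum_of_nonneg fun _ _ => by positivity,
    ← ENNReal.ofReal_natCast, ← ENNReal.ofReal_inv_of_pos hK,
    ← ENNReal.ofReal_mul (by positivity), ← Finset.mul_sum]
  refine ENNReal.ofReal_le_ofReal ?_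
  rw [norm_inv, Real.norm_natCast]
  have h1 : ∑ σ : Equiv.Perm (Fin n), ‖∑ j ∈ J, (Y (σ j) - m)‖ ^ 2
      ≤ (n : ℝ)⁻¹ * (B * ((Fintype.card (Equiv.Perm (Fin n)) : ℝ) * ∑ i, ‖Y i - m‖ ^ 2)) := by
    rw [le_inv_mul_iff₀ hn']
    exact hsum
  refine (mul_le_mul_of_nonneg_left (mul_le_mul_of_nonneg_left h1 (by positivity))
    (by positivity)).trans_eq ?_
  field_simp

/-- The average over a complete sample without replacement is exact. -/
theorem lintegral_orderingLaw_norm_average_sq_self {n : ℕ} {Y : Fin n → H} {m : H}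
    (hm : m = (1 / n : ℝ) • ∑ i, Y i) :
    ∫⁻ ζ, ENNReal.ofReal (‖(n : ℝ)⁻¹ • ∑ j : Fin n with j.val < n, Y (ζ j) - m‖ ^ 2)
        ∂(orderingLaw n) = 0 := by
  rw [lintegral_orderingLaw]
  have : ∀ σ : Equiv.Perm (Fin n), ∑ j : Fin n with j.val < n, Y (σ j) = ∑ i, Y i := fun σ => by
    rw [Finset.filter_true_of_mem fun j _ => j.isLt]
    exact Equiv.sum_comp σ Y
  simp only [this, hm, one_div, sub_self]
  simp

theorem isProbabilityMeasure_orderingLaw (n : ℕ) : IsProbabilityMeasure (orderingLaw n) :=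
  ProbabilityTheory.isProbabilityMeasure_uniformOn' (Set.toFinite _)
    ⟨id, Function.injective_id⟩ (Set.toFinite _).measurableSet

end Ordering

/-! ### The adaptive batch size -/

section BatchSize

variable {M : Type*}

theorem inv_ceil_mul_sq_le {σ α α' β : ℝ} (hσ : 0 < σ) (hα : 0 < α) (hα' : α ≤ α')
    (hβ : 0 < β) : (⌈α' * σ ^ 2 / β⌉₊ : ℝ)⁻¹ * σ ^ 2 ≤ β / α := by
  have h1 : α' * σ ^ 2 / β ≤ ⌈α' * σ ^ 2 / β⌉₊ := Nat.le_ceil _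
  have hα'0 : 0 < α' := hα.trans_le hα'
  have h0 : 0 < α' * σ ^ 2 / β := by positivity
  calc (⌈α' * σ ^ 2 / β⌉₊ : ℝ)⁻¹ * σ ^ 2 ≤ (α' * σ ^ 2 / β)⁻¹ * σ ^ 2 := by gcongr
    _ = β / α' := by field_simp
    _ ≤ β / α := by gcongr

theorem Input.batchSize_le (A : Input M) (β : ℝ) : A.batchSize β ≤ A.cap := by
  unfold Input.batchSize
  split_ifs
  · exact le_rfl
  · exact min_le_right _ _

theorem Input.batchSize_pos {A : Input M} (hσ : 0 < A.σ) (hα₁ : 0 < A.α₁) (hcap : 0 < A.cap)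
    {β : ℝ} (hβ : 0 ≤ β) : 0 < A.batchSize β := by
  unfold Input.batchSize
  split_ifs with h
  · exact hcap
  · have : 0 < β := lt_of_le_of_ne hβ (Ne.symm h)
    exact lt_min (Nat.ceil_pos.2 (by positivity)) hcap

/-- The dichotomy behind `(β + ε²)/α`: an uncapped batch is paid for by `β`, the cap by `ε²`. For `β
= 0` the size is the cap by definition. -/
theorem Input.batchSize_eq_cap_or {A : Input M} (hσ : 0 < A.σ) {α : ℝ} (hα : 0 < α)
    (hα₁ : α ≤ A.α₁) {β : ℝ} (hβ : 0 ≤ β) :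
    A.batchSize β = A.cap ∨ (A.batchSize β : ℝ)⁻¹ * A.σ ^ 2 ≤ β / α := by
  unfold Input.batchSize
  split_ifs with h
  · exact Or.inl rfl
  · have hβ' : 0 < β := lt_of_le_of_ne hβ (Ne.symm h)
    rcases le_total ⌈A.α₁ * A.σ ^ 2 / β⌉₊ A.cap with hle | hle
    · right
      rw [min_eq_left hle]
      exact inv_ceil_mul_sq_le hσ hα hα₁ hβ'
    · exact Or.inl (min_eq_right hle)

end BatchSize

/-! ### Mean square error of the snapshot batch -/

section BatchError

variable {E : Type*} [NormedAddCommGroup E] [NormedSpace ℝ E] [FiniteDimensional ℝ E]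
  {M : Type*} [EMetricSpace M] [ChartedSpace E M] [IsManifold 𝓘(ℝ, E) ∞ M]
  [RiemannianBundle (fun x : M => TangentSpace 𝓘(ℝ, E) x)]
  {R : Retraction E M} {T : VectorTransport R} {ρ : ℝ} {X : Set M} {xstar : M}
  {G L Ll θ μ ν : ℝ} {A : Input M} {ε α α₂ : ℝ}

/-- The error of a batch drawn without replacement. -/
theorem lintegral_batchGrad_orderingLaw_le {n : ℕ} {F : Fin n → M → ℝ} (hn : 0 < n)
    (hcap : A.cap = n ∨ A.cap = min ⌈α₂ * A.σ ^ 2 / ε ^ 2⌉₊ n)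
    (hA : Assumptions R T ρ X xstar (ProbabilityTheory.uniformOn Set.univ) F G A.σ L Ll θ μ ν)
    (hε : 0 < ε) (hα : 0 < α) (hα₁ : α ≤ A.α₁) (hα₂ : α ≤ α₂) {β : ℝ} (hβ : 0 ≤ β) {x : M}
    (hx : x ∈ X) :
    ∫⁻ ζ, ENNReal.ofReal (‖batchGrad F (A.batchSize β) ζ x
        - grad E (objective (ProbabilityTheory.uniformOn Set.univ) F) x‖ ^ 2) ∂(orderingLaw n)
      ≤ ENNReal.ofReal ((β + ε ^ 2) / α) := by
  have hσ : 0 < A.σ := hA.pos.2.2.1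
  have hc0 : 0 < ⌈α₂ * A.σ ^ 2 / ε ^ 2⌉₊ := by
    have : 0 < α₂ := hα.trans_le hα₂
    exact Nat.ceil_pos.2 (by positivity)
  have hcap0 : 0 < A.cap := by
    rcases hcap with h | h
    · exact h ▸ hn
    · exact h ▸ lt_min hc0 hn
  have hcapn : A.cap ≤ n := by
    rcases hcap with h | h
    · exact h.le
    · exact h.le.trans (min_le_right _ _)
  have hm := grad_average (E := E) (x := x) fun i =>
    (hA.contMDiff_component i).contMDiffAt.mdifferentiableAt (by norm_num)
  have hvar := hA.variance_bound x hx
  rw [integral_uniformOn_univ, smul_eq_mul] at hvar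
  have hsmall : (A.batchSize β : ℝ)⁻¹ * A.σ ^ 2 ≤ (β + ε ^ 2) / α →
      ∫⁻ ζ, ENNReal.ofReal (‖batchGrad F (A.batchSize β) ζ x
        - grad E (objective (ProbabilityTheory.uniformOn Set.univ) F) x‖ ^ 2) ∂(orderingLaw n)
      ≤ ENNReal.ofReal ((β + ε ^ 2) / α) := fun h => by
    refine (lintegral_orderingLaw_norm_average_sq_le
      (A.batchSize_pos hσ (hα.trans_le hα₁) hcap0 hβ)
      ((A.batchSize_le β).trans hcapn) hm).trans (ENNReal.ofReal_le_ofReal (le_trans ?_ h))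
    exact mul_le_mul_of_nonneg_left hvar (by positivity)
  -- A complete batch is a permutation of all components and has no error, so no lower bound on `n`
  -- is needed.
  have hfull : A.batchSize β = n →
      ∫⁻ ζ, ENNReal.ofReal (‖batchGrad F (A.batchSize β) ζ x
        - grad E (objective (ProbabilityTheory.uniformOn Set.univ) F) x‖ ^ 2) ∂(orderingLaw n)
      ≤ ENNReal.ofReal ((β + ε ^ 2) / α) := fun h => by
    rw [h]
    exact (lintegral_orderingLaw_norm_average_sq_self hm).trans_le zero_le
  rcases A.batchSize_eq_cap_or hσ hα hα₁ hβ with h | h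
  · rcases hcap with hc | hc
    · exact hfull (h.trans hc)
    rcases le_total ⌈α₂ * A.σ ^ 2 / ε ^ 2⌉₊ n with hle | hle
    · refine hsmall ?_
      rw [h, hc, min_eq_left hle]
      refine (inv_ceil_mul_sq_le hσ hα hα₂ (by positivity)).trans ?_
      gcongr
      linarith
    · exact hfull (h.trans (hc.trans (min_eq_right hle)))
  · refine hsmall (h.trans ?_)
    gcongr
    linarith [sq_nonneg ε]

/-- The error of a batch of independent samples. -/
theorem lintegral_batchGrad_pi_le {Z : Type*} [MeasurableSpace Z] {D : Measure Z}
    [IsProbabilityMeasure D] {F : Z → M → ℝ} (hcap : A.cap = ⌈α₂ * A.σ ^ 2 / ε ^ 2⌉₊)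
    (hA : Assumptions R T ρ X xstar D F G A.σ L Ll θ μ ν) (hU : UnbiasedOracle E X D F)
    (hε : 0 < ε) (hα : 0 < α) (hα₁ : α ≤ A.α₁) (hα₂ : α ≤ α₂) {β : ℝ} (hβ : 0 ≤ β) {x : M}
    (hx : x ∈ X) :
    ∫⁻ ζ : Fin A.cap → Z, ENNReal.ofReal (‖batchGrad F (A.batchSize β) ζ x
        - grad E (objective D F) x‖ ^ 2) ∂(Measure.pi fun _ => D)
      ≤ ENNReal.ofReal ((β + ε ^ 2) / α) := by
  have hσ : 0 < A.σ := hA.pos.2.2.1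
  have hcap0 : 0 < A.cap := by
    have : 0 < α₂ := hα.trans_le hα₂
    rw [hcap]
    exact Nat.ceil_pos.2 (by positivity)
  have hfd : FiniteDimensional ℝ (TangentSpace 𝓘(ℝ, E) x) := ‹FiniteDimensional ℝ E›
  have hY : MemLp (fun z => grad E (F z) x) 2 D :=
    MemLp.of_bound (hU.measurable x hx) G (ae_of_all _ fun z => hA.grad_bound z x hx)
  -- Taken with offset `0`: only the variance of the average remains.
  have h := lintegral_norm_average_sq (A.batchSize_pos hσ (hα.trans_le hα₁) hcap0 hβ)
    (A.batchSize_le β) hY 0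
  simp only [hU.unbiased x hx, add_zero] at h
  refine h.trans_le (ENNReal.ofReal_le_ofReal ?_)
  rw [norm_zero, zero_pow two_ne_zero, add_zero]
  refine (mul_le_mul_of_nonneg_left (hA.variance_bound x hx) (by positivity)).trans ?_
  rcases A.batchSize_eq_cap_or hσ hα hα₁ hβ with h | h
  · rw [h, hcap]
    refine (inv_ceil_mul_sq_le hσ hα hα₂ (by positivity)).trans ?_
    gcongr
    linarith
  · refine h.trans ?_
    gcongr
    linarith [sq_nonneg ε]

end BatchError

end RAba

end

/-! ### The two sampling regimes -/

theorem mainTheorem3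
    {E : Type*} [NormedAddCommGroup E] [NormedSpace ℝ E] [FiniteDimensional ℝ E]
    {M : Type*} [EMetricSpace M] [ChartedSpace E M] [IsManifold 𝓘(ℝ, E) ∞ M]
    [RiemannianBundle (fun x : M => TangentSpace 𝓘(ℝ, E) x)]
    [IsContMDiffRiemannianBundle 𝓘(ℝ, E) ∞ E (fun x : M => TangentSpace 𝓘(ℝ, E) x)]
    [IsRiemannianManifold 𝓘(ℝ, E) M]
    (R : RAba.Retraction E M) (T : RAba.VectorTransport R) (X : Set M) (xstar : M)
    (ρ G L Ll θ μ ν : ℝ) (A : RAba.Input M) (hS : 0 < A.S) (hm : 0 < A.m) (hb : 0 < A.b)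
    (ε α α₂ : ℝ) (hε : 0 < ε) (hα : 4 ≤ α) (hα₁ : α ≤ A.α₁) (hα₂ : α ≤ α₂)
    (hβ₁ : 0 ≤ A.β₁) (hβ₁' : A.β₁ ≤ ε ^ 2 * A.S) (hη : 0 < A.η)
    (hη' : A.η ≤ (2 - 2 / α) /
      (L + √(L ^ 2 + 4 * (1 - 1 / α) * ((Ll + θ * G) ^ 2 * μ ^ 2 * ν ^ 2 * A.m ^ 2 / A.b)))) :
    -- `n` components, batches drawn without replacement; the largest batch size is `n` in the
    -- finite-sum setting and `min {α₂ σ² / ε², n}` in the online setting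
    (∀ (n : ℕ) (F : Fin n → M → ℝ), 0 < n →
      (A.cap = n ∨ A.cap = min ⌈α₂ * A.σ ^ 2 / ε ^ 2⌉₊ n) →
      RAba.Assumptions R T ρ X xstar (ProbabilityTheory.uniformOn Set.univ) F G A.σ L Ll θ μ ν →
      (∀ᵐ smp ∂(RAba.sampleLaw A.S A.m A.b n (RAba.orderingLaw n)
        (ProbabilityTheory.uniformOn Set.univ)), RAba.StaysIn T ρ F A smp X) →
      RAba.OutputBound T ρ F A (RAba.objective (ProbabilityTheory.uniformOn Set.univ) F)
        (RAba.sampleLaw A.S A.m A.b n (RAba.orderingLaw n)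
          (ProbabilityTheory.uniformOn Set.univ))
        (2 * (RAba.objective (ProbabilityTheory.uniformOn Set.univ) F A.start -
            RAba.objective (ProbabilityTheory.uniformOn Set.univ) F xstar) /
          ((A.S * A.m : ℕ) * A.η) + ε ^ 2 / 2)) ∧
    -- online setting with an arbitrary law `D` of the components: the batches are i.i.d. samples
    -- and the largest batch size is `α₂ σ² / ε²`
    (∀ (Z : Type*) [MeasurableSpace Z] (D : Measure Z) [IsProbabilityMeasure D]
      (F : Z → M → ℝ),
      A.cap = ⌈α₂ * A.σ ^ 2 / ε ^ 2⌉₊ →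
      RAba.Assumptions R T ρ X xstar D F G A.σ L Ll θ μ ν →
      RAba.UnbiasedOracle E X D F →
      RAba.IsMeasurableRun T ρ F A A.cap →
      (∀ᵐ smp ∂(RAba.sampleLaw A.S A.m A.b A.cap (Measure.pi fun _ => D) D),
        RAba.StaysIn T ρ F A smp X) →
      RAba.OutputBound T ρ F A (RAba.objective D F)
        (RAba.sampleLaw A.S A.m A.b A.cap (Measure.pi fun _ => D) D)
        (2 * (RAba.objective D F A.start - RAba.objective D F xstar) /
          ((A.S * A.m : ℕ) * A.η) + ε ^ 2 / 2)) := by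
  have hα0 : 0 < α := by linarith
  refine ⟨fun n F hn hcap hA hstay => ?_, fun Z _ D _ F hcap hA hU hrun hstay => ?_⟩
  · have : NeZero n := ⟨hn.ne'⟩
    have hQ := RAba.isProbabilityMeasure_orderingLaw n
    exact RAba.outputBound_of_batch hA
      (RAba.unbiasedOracle_uniformOn hn hA.contMDiff_component X) hS hm hb hη hα hβ₁ hβ₁'
      (fun s t => by
        borelize (TangentBundle 𝓘(ℝ, E) M)
        -- With finitely many components the sample space is finite, so the run is automatically
        -- measurable.
        exact measurable_of_finite _) hstay
      (fun β hβ x hx => RAba.lintegral_batchGrad_orderingLaw_le hn hcap hA hε hα0 hα₁ hα₂ hβ hx)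
      hη'
  · exact RAba.outputBound_of_batch hA hU hS hm hb hη hα hβ₁ hβ₁' hrun hstay
      (fun β hβ x hx => RAba.lintegral_batchGrad_pi_le hcap hA hU hε hα0 hα₁ hα₂ hβ hx) hη'
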